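/- **Setting.** For an integer $r\ge 1$ let $J^{r-1}(\mathbb R)$ be the space of $(r-1)$-jets of functions on $\mathbb R$, with coordinates $(x,u_{r-1},\dots,u_0)\in\mathbb R\times\mathbb R^r$ (the jet of $g$ at $y$ has $x=y$ and $u_i=g^{(i)}(y)$). An absolutely continuous curve in it is horizontal if $u_i'=u_{i+1}x'$ a.e. for $0\le i\le r-2$; its length is $\int\sqrt{(x')^2+(u_{r-1}')^2}$. The Carnot–Carathéodory metric $d_{CC}(v,w)$ is the infimum of the lengths of the horizontal curves from $v$ to $w$. A set $N\subseteq J^{r-1}(\mathbb R)$ is coarsely dense with constant $K<\infty$ if every point of $J^{r-1}(\mathbb R)$ is at $d_{CC}$-distance at most $K$ from some point of $N$, and coarsely dense if this holds for some $K$. Put $B_N(R)=\{v\in N: d_{CC}(0,v)\le R\}$. For $p>0$ and a metric space $(M,d)$, the Markov $p$-convexity constant $\Pi_p(M)\in[0,\infty]$ is the infimum of those $\Pi<\infty$ such that for every (discrete, possibly time-inhomogeneous) Markov chain $(X_t)_{t\in\mathbb Z}$ on a state space $\Omega$ and every $f:\Omega\to M$, $$\sum_{k=0}^{\infty}\sum_{t\in\mathbb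 Z}\frac{\mathbb E\big[d(f(X_t),f(\tilde X_t(t-2^k)))^p\big]}{2^{kp}}\le \Pi^p\sum_{t\in\mathbb Z}\mathbb E\big[d(f(X_{t+1}),f(X_t))^p\big],$$ where $\tilde X(s)$ is the process that equals $X$ up to time $s$ and evolves independently, with the same transition probabilities, after time $s$ ($\Pi_p(M)=\infty$ if there is no such $\Pi$). **Theorem.** Let $p>0$ and let $r\ge1$ be an integer. 1. There is a constant $c>0$, depending only on $p$ and $r$, such that for every $K\ge1$, every $N\subseteq J^{r-1}(\mathbb R)$ that is coarsely dense with constant $K$, and every $R\ge 3K^2$, $$\Pi_p(B_N(R))\ \ge\ c\,\frac{(\ln R)^{\frac1p-\frac1{2r}}}{(\ln\ln R)^{\frac1p+\frac1{2r}}}.$$ In particular, if $N$ is coarsely dense with constant $1$, this holds for all $R\ge3$. 2. For every coarsely dense $N\subseteq J^{r-1}(\mathbb R)$ there is a constant $c>0$, depending only on $p$, $r$ and $N$, such that the same inequality holds for every $R\ge3$ for which $B_N(R)$ has at least two points. -/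

import Mathlib

open MeasureTheory Set
open scoped ENNReal NNReal

/-! ### Markov chains indexed by `ℤ` and Markov convexity -/

/-- A (possibly time-inhomogeneous) discrete Markov chain `(X_t)` indexed by `t : ℤ` on the state
space `Ω`: `law t` is the distribution of `X_t`, and `trans t x` is the conditional distribution of
`X_{t+1}` given `X_t = x`. -/
structure MarkovChain (Ω : Type) where
  law : ℤ → PMF Ω
  trans : ℤ → Ω → PMF Ω
  law_succ : ∀ t, law (t + 1) = (law t).bind (trans t)

namespace MarkovChain

variable {Ω : Type} (X : MarkovChain Ω)

/-- The joint law of the two consecutive states `(X_t, X_{t+1})`. -/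
noncomputable def stepLaw (t : ℤ) : PMF (Ω × Ω) :=
  (X.law t).bind fun x => (X.trans t x).map fun y => (x, y)

/-- The joint law of `(X_{k+n}, X̃_{k+n}(k))`. The two processes agree at time `k`, and from then on
each makes its next step independently of the other one, with the transition probabilities of the
chain. -/
noncomputable def branchLaw (k : ℤ) : ℕ → PMF (Ω × Ω)
  | 0 => (X.law k).map fun x => (x, x)
  | n + 1 => (branchLaw k n).bind fun z =>
      (X.trans (k + n) z.1).bind fun x => (X.trans (k + n) z.2).map fun y => (x, y)

/-- The joint law of `(X_t, X̃_t(k))`, where `X̃(k)` is the process that equals `X` up to time `k` and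
evolves independently, with the same transition probabilities, after time `k`. -/
noncomputable def pairLaw (t k : ℤ) : PMF (Ω × Ω) :=
  if t ≤ k then (X.law t).map fun x => (x, x) else X.branchLaw k (t - k).toNat

end MarkovChain

/-- The expectation of `d(f(Y), f(Z)) ^ p` for a pair `(Y, Z)` with joint law `ν`. -/
noncomputable def expectedDistPow {Ω M : Type*} [PseudoEMetricSpace M] (p : ℝ) (f : Ω → M)
    (ν : PMF (Ω × Ω)) : ℝ≥0∞ :=
  ∑' z : Ω × Ω, ν z * edist (f z.1) (f z.2) ^ p

/-- The Markov `p`-convexity inequality with constant `C`. -/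
def MarkovConvexWith (p : ℝ) (M : Type*) [PseudoEMetricSpace M] (C : ℝ≥0) : Prop :=
  ∀ (Ω : Type) (X : MarkovChain Ω) (f : Ω → M),
    ∑' k : ℕ, ∑' t : ℤ,
        expectedDistPow p f (X.pairLaw t (t - 2 ^ k)) / (2 : ℝ≥0∞) ^ ((k : ℝ) * p)
      ≤ (C : ℝ≥0∞) ^ p * ∑' t : ℤ, expectedDistPow p f (X.stepLaw t)

/-- The Markov `p`-convexity constant `Π_p(M)`, the least constant in the Markov `p`-convexity
inequality; it is `∞` if `M` is not Markov `p`-convex. -/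
noncomputable def markovConvexityConst (p : ℝ) (M : Type*) [PseudoEMetricSpace M] : ℝ≥0∞ :=
  ⨅ (C : ℝ≥0) (_ : MarkovConvexWith p M C), (C : ℝ≥0∞)

/-- `N` is coarsely dense with constant `K`: the closed balls of radius `K` centred in `N` cover. -/
def CoarselyDenseWith {M : Type*} [PseudoEMetricSpace M] (K : ℝ≥0) (N : Set M) : Prop :=
  ∀ x, ∃ y ∈ N, edist x y ≤ K

/-- A set is coarsely dense if it is so with some finite constant. -/
def CoarselyDense {M : Type*} [PseudoEMetricSpace M] (N : Set M) : Prop :=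
  ∃ K : ℝ≥0, CoarselyDenseWith K N

/-! ### Jet spaces over `ℝ` -/

/-- The jet space `J^n(ℝ)`, a Carnot group of step `n + 1`, in the coordinates `x` and
`u_0, …, u_n`: the jet at `y` of a function `g` has `x = y` and `u_i = g^{(i)}(y)`. -/
@[ext]
structure JetSpace (n : ℕ) where
  x : ℝ
  u : Fin (n + 1) → ℝ

namespace JetSpace

variable {n : ℕ}

instance : Zero (JetSpace n) := ⟨⟨0, 0⟩⟩

/-- `γ` restricted to `[a, b]` is an absolutely continuous curve that is horizontal, that is, a.e.
tangent to the span of the left invariant fields `∂_x + u_1 ∂_{u_0} + ⋯ + u_n ∂_{u_{n-1}}` and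
`∂_{u_n}`. -/
structure IsHorizontal (γ : ℝ → JetSpace n) (a b : ℝ) : Prop where
  ac_x : AbsolutelyContinuousOnInterval (fun t => (γ t).x) a b
  ac_u : ∀ i, AbsolutelyContinuousOnInterval (fun t => (γ t).u i) a b
  deriv_u : ∀ i : Fin n, ∀ᵐ t ∂volume.restrict (Icc a b),
    deriv (fun s => (γ s).u i.castSucc) t = (γ t).u i.succ * deriv (fun s => (γ s).x) t

/-- The length of a horizontal curve, for the inner product in which the two horizontal fields
`∂_x + u_1 ∂_{u_0} + ⋯ + u_n ∂_{u_{n-1}}` and `∂_{u_n}` are orthonormal. -/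
noncomputable def length (γ : ℝ → JetSpace n) (a b : ℝ) : ℝ≥0∞ :=
  ∫⁻ t in Icc a b, ENNReal.ofReal
    (√(deriv (fun s => (γ s).x) t ^ 2 + deriv (fun s => (γ s).u (Fin.last n)) t ^ 2))

/-- The Carnot–Carathéodory distance: the infimum of the lengths of the horizontal curves that join
`v` to `w`. -/
noncomputable def dCC (v w : JetSpace n) : ℝ≥0∞ :=
  ⨅ (a : ℝ) (b : ℝ) (γ : ℝ → JetSpace n)
    (_ : a ≤ b ∧ IsHorizontal γ a b ∧ γ a = v ∧ γ b = w), length γ a b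

theorem dCC_le {v w : JetSpace n} {γ : ℝ → JetSpace n} {a b : ℝ} (hab : a ≤ b)
    (h : IsHorizontal γ a b) (ha : γ a = v) (hb : γ b = w) : dCC v w ≤ length γ a b :=
  iInf_le_of_le a <| iInf_le_of_le b <| iInf_le_of_le γ <| iInf_le _ ⟨hab, h, ha, hb⟩


/-! The distance `dCC` satisfies the axioms of an extended pseudometric. -/

theorem ac_congr {f g : ℝ → ℝ} {a b : ℝ} (hf : AbsolutelyContinuousOnInterval f a b)
    (h : EqOn f g (uIcc a b)) : AbsolutelyContinuousOnInterval g a b := by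
  rw [absolutelyContinuousOnInterval_iff] at hf ⊢
  intro ε hε
  obtain ⟨δ, hδ, H⟩ := hf ε hε
  refine ⟨δ, hδ, fun E hE hlt => ?_⟩
  have := H E hE hlt
  rwa [Finset.sum_congr rfl fun i hi => by rw [h (hE.1 i hi).1, h (hE.1 i hi).2]] at this

theorem ac_of_integral {f g : ℝ → ℝ} {a b : ℝ} (hg : IntervalIntegrable g volume a b)
    (h : ∀ t ∈ uIcc a b, f t = f a + ∫ s in a..t, g s) :
    AbsolutelyContinuousOnInterval f a b := by
  have h1 : AbsolutelyContinuousOnInterval (fun _ : ℝ => f a) a b :=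
    ((LipschitzWith.const (f a)).lipschitzOnWith (s := uIcc a b)).absolutelyContinuousOnInterval
  exact ac_congr (h1.add (hg.absolutelyContinuousOnInterval_intervalIntegral left_mem_uIcc))
    fun t ht => (h t ht).symm

theorem ac_integral {f : ℝ → ℝ} {a b t : ℝ} (hf : AbsolutelyContinuousOnInterval f a b)
    (ht : t ∈ uIcc a b) : ∫ s in a..t, deriv f s = f t - f a :=
  (hf.mono (uIcc_subset_uIcc_left ht)).integral_deriv_eq_sub

theorem ac_shift {f : ℝ → ℝ} {a b : ℝ} (d : ℝ) (hf : AbsolutelyContinuousOnInterval f a b) :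
    AbsolutelyContinuousOnInterval (fun t => f (t + d)) (a - d) (b - d) := by
  refine ac_of_integral (g := fun s => deriv f (s + d)) (hf.intervalIntegrable_deriv.comp_add_right d)
    fun t ht => ?_
  have ht' : t + d ∈ uIcc a b := by
    rw [mem_uIcc] at ht ⊢
    rcases ht with h | h
    · left; constructor <;> linarith
    · right; constructor <;> linarith
  rw [intervalIntegral.integral_comp_add_right (deriv f) d, sub_add_cancel, ac_integral hf ht']
  ring

theorem ac_reverse {f : ℝ → ℝ} {a b : ℝ} (hf : AbsolutelyContinuousOnInterval f a b) :
    AbsolutelyContinuousOnInterval (fun t => f (0 - t)) (0 - b) (0 - a) := by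
  refine ac_of_integral (g := fun s => -deriv f (0 - s))
    (hf.symm.intervalIntegrable_deriv.comp_sub_left 0).neg fun t ht => ?_
  have ht' : 0 - t ∈ uIcc b a := by
    rw [mem_uIcc] at ht ⊢
    rcases ht with h | h
    · right; constructor <;> linarith
    · left; constructor <;> linarith
  rw [intervalIntegral.integral_neg, intervalIntegral.integral_comp_sub_left (deriv f) 0,
    sub_sub_cancel, intervalIntegral.integral_symm, ac_integral hf.symm ht']
  ring

theorem ac_concat {f g : ℝ → ℝ} {a b c : ℝ} (hab : a ≤ b) (hbc : b ≤ c)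
    (hf : AbsolutelyContinuousOnInterval f a b) (hg : AbsolutelyContinuousOnInterval g b c)
    (hb : f b = g b) :
    AbsolutelyContinuousOnInterval (fun t => if t ≤ b then f t else g t) a c := by
  have key1 : ∀ t, t < b → deriv (fun t => if t ≤ b then f t else g t) t = deriv f t := fun t ht =>
    Filter.EventuallyEq.deriv_eq <| by
      filter_upwards [Iio_mem_nhds ht] with s hs
      simp [le_of_lt (show s < b from hs)]
  have key2 : ∀ t, b < t → deriv (fun t => if t ≤ b then f t else g t) t = deriv g t := fun t ht =>
    Filter.EventuallyEq.deriv_eq <| by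
      filter_upwards [Ioi_mem_nhds ht] with s hs
      simp [not_le_of_gt (show b < s from hs)]
  set F := fun t => if t ≤ b then f t else g t
  have e1 : ∀ t ∈ Icc a b, ∫ s in a..t, deriv F s = f t - f a := fun t ht => by
    rw [← ac_integral hf (by rwa [uIcc_of_le hab])]
    refine intervalIntegral.integral_congr_ae ?_
    filter_upwards [Measure.ae_ne volume b] with s hs hs'
    rw [uIoc_of_le ht.1] at hs'
    exact key1 s (lt_of_le_of_ne (hs'.2.trans ht.2) hs)
  have e2 : ∀ t ∈ Icc b c, ∫ s in b..t, deriv F s = g t - g b := fun t ht => by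
    rw [← ac_integral hg (by rwa [uIcc_of_le hbc])]
    refine intervalIntegral.integral_congr_ae ?_
    filter_upwards with s hs'
    rw [uIoc_of_le ht.1] at hs'
    exact key2 s hs'.1
  have i1 : IntervalIntegrable (deriv F) volume a b := by
    refine hf.intervalIntegrable_deriv.congr_ae ?_
    rw [uIoc_of_le hab]
    filter_upwards [ae_restrict_mem measurableSet_Ioc, Measure.ae_ne (volume.restrict _) b]
      with s hs hs'
    exact (key1 s (lt_of_le_of_ne hs.2 hs')).symm
  have i2 : IntervalIntegrable (deriv F) volume b c := by
    refine hg.intervalIntegrable_deriv.congr_ae ?_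
    rw [uIoc_of_le hbc]
    filter_upwards [ae_restrict_mem measurableSet_Ioc] with s hs
    exact (key2 s hs.1).symm
  refine ac_of_integral (i1.trans i2) fun t ht => ?_
  rw [uIcc_of_le (hab.trans hbc)] at ht
  have hFa : F a = f a := if_pos hab
  rcases le_or_gt t b with h | h
  · rw [e1 t ⟨ht.1, h⟩, hFa, show F t = f t from if_pos h]
    ring
  · have i3 : IntervalIntegrable (deriv F) volume b t :=
      i2.mono_set (by rw [uIcc_of_le h.le, uIcc_of_le hbc]; exact Icc_subset_Icc_right ht.2)
    rw [← intervalIntegral.integral_add_adjacent_intervals i1 i3, e1 b ⟨hab, le_rfl⟩,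
      e2 t ⟨h.le, ht.2⟩, hFa, show F t = g t from if_neg (not_le_of_gt h), hb]
    ring

theorem dCC_self (v : JetSpace n) : dCC v v = 0 := by
  refine le_antisymm ((dCC_le (γ := fun _ => v) (le_refl (0 : ℝ)) ⟨?_, fun i => ?_, fun i => ?_⟩
    rfl rfl).trans (by simp [length])) zero_le
  · exact ((LipschitzWith.const v.x).lipschitzOnWith (s := uIcc 0 0)).absolutelyContinuousOnInterval
  · exact ((LipschitzWith.const (v.u i)).lipschitzOnWith (s := uIcc 0 0)).absolutelyContinuousOnInterval
  · simp

theorem IsHorizontal.reverse {γ : ℝ → JetSpace n} {a b : ℝ} (h : IsHorizontal γ a b) :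
    IsHorizontal (fun t => γ (0 - t)) (0 - b) (0 - a) where
  ac_x := ac_reverse (f := fun t => (γ t).x) h.ac_x
  ac_u i := ac_reverse (f := fun t => (γ t).u i) (h.ac_u i)
  deriv_u i := by
    have mp := (Measure.measurePreserving_sub_left (volume : Measure ℝ) 0).restrict_preimage_emb
      (MeasurableEquiv.subLeft (0 : ℝ)).measurableEmbedding (Icc a b)
    rw [preimage_const_sub_Icc] at mp
    refine (mp.quasiMeasurePreserving.tendsto_ae.eventually (h.deriv_u i)).mono fun t ht => ?_
    have e1 := deriv_comp_const_sub (fun s => (γ s).u i.castSucc) 0 t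
    have e2 := deriv_comp_const_sub (fun s => (γ s).x) 0 t
    exact e1.trans ((congrArg Neg.neg ht).trans
      ((mul_neg _ _).symm.trans (congrArg _ e2.symm)))

theorem length_reverse (γ : ℝ → JetSpace n) (a b : ℝ) :
    length (fun t => γ (0 - t)) (0 - b) (0 - a) = length γ a b := by
  have := (Measure.measurePreserving_sub_left (volume : Measure ℝ) 0).setLIntegral_comp_preimage_emb
      (MeasurableEquiv.subLeft (0 : ℝ)).measurableEmbedding (fun t => ENNReal.ofReal
    (√(deriv (fun s => (γ s).x) t ^ 2 + deriv (fun s => (γ s).u (Fin.last n)) t ^ 2))) (Icc a b)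
  rw [preimage_const_sub_Icc] at this
  rw [length, length, ← this]
  refine lintegral_congr fun t => ?_
  rw [deriv_comp_const_sub (fun s => (γ s).u (Fin.last n)) 0,
      deriv_comp_const_sub (fun s => (γ s).x) 0, neg_sq, neg_sq]

theorem dCC_comm_le (v w : JetSpace n) : dCC w v ≤ dCC v w := by
  refine le_iInf fun a => le_iInf fun b => le_iInf fun γ => le_iInf fun ⟨hab, h, ha, hb⟩ => ?_
  rw [← length_reverse γ a b]
  exact dCC_le (by linarith) h.reverse (by simpa using hb) (by simpa using ha)

theorem IsHorizontal.shift {γ : ℝ → JetSpace n} {a b : ℝ} (d : ℝ) (h : IsHorizontal γ a b) :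
    IsHorizontal (fun t => γ (t + d)) (a - d) (b - d) where
  ac_x := ac_shift (f := fun t => (γ t).x) d h.ac_x
  ac_u i := ac_shift (f := fun t => (γ t).u i) d (h.ac_u i)
  deriv_u i := by
    have mp := (measurePreserving_add_right (volume : Measure ℝ) d).restrict_preimage_emb
      (MeasurableEquiv.addRight d).measurableEmbedding (Icc a b)
    rw [preimage_add_const_Icc] at mp
    refine (mp.quasiMeasurePreserving.tendsto_ae.eventually (h.deriv_u i)).mono fun t ht => ?_
    have e1 := deriv_comp_add_const (fun s => (γ s).u i.castSucc) d t
    have e2 := deriv_comp_add_const (fun s => (γ s).x) d t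
    exact e1.trans (ht.trans (congrArg _ e2.symm))

theorem length_shift (γ : ℝ → JetSpace n) (a b d : ℝ) :
    length (fun t => γ (t + d)) (a - d) (b - d) = length γ a b := by
  have := (measurePreserving_add_right (volume : Measure ℝ) d).setLIntegral_comp_preimage_emb
      (MeasurableEquiv.addRight d).measurableEmbedding (fun t => ENNReal.ofReal
    (√(deriv (fun s => (γ s).x) t ^ 2 + deriv (fun s => (γ s).u (Fin.last n)) t ^ 2))) (Icc a b)
  rw [preimage_add_const_Icc] at this
  rw [length, length, ← this]
  refine lintegral_congr fun t => ?_
  rw [deriv_comp_add_const (fun s => (γ s).u (Fin.last n)) d,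
      deriv_comp_add_const (fun s => (γ s).x) d]

theorem concat_eventually {γ η : ℝ → JetSpace n} {b t : ℝ} (g : JetSpace n → ℝ) (ht : t ≠ b) :
    deriv (fun s => g (if s ≤ b then γ s else η s)) t =
      if t ≤ b then deriv (fun s => g (γ s)) t else deriv (fun s => g (η s)) t := by
  rcases lt_or_gt_of_ne ht with h | h
  · rw [if_pos h.le]
    refine Filter.EventuallyEq.deriv_eq ?_
    filter_upwards [Iio_mem_nhds h] with s hs
    rw [if_pos (le_of_lt (show s < b from hs))]
  · rw [if_neg (not_le_of_gt h)]
    refine Filter.EventuallyEq.deriv_eq ?_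
    filter_upwards [Ioi_mem_nhds h] with s hs
    rw [if_neg (not_le_of_gt (show b < s from hs))]

theorem IsHorizontal.concat {γ η : ℝ → JetSpace n} {a b c : ℝ} (hab : a ≤ b) (hbc : b ≤ c)
    (h : IsHorizontal γ a b) (h' : IsHorizontal η b c) (hb : γ b = η b) :
    IsHorizontal (fun t => if t ≤ b then γ t else η t) a c where
  ac_x := by
    simp only [apply_ite JetSpace.x]
    exact ac_concat hab hbc h.ac_x h'.ac_x (congrArg JetSpace.x hb)
  ac_u i := by
    simp only [apply_ite (fun v : JetSpace n => v.u i)]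
    exact ac_concat hab hbc (h.ac_u i) (h'.ac_u i) (congrArg (fun v : JetSpace n => v.u i) hb)
  deriv_u i := by
    have h1 := (ae_restrict_iff' measurableSet_Icc).1 (h.deriv_u i)
    have h2 := (ae_restrict_iff' measurableSet_Icc).1 (h'.deriv_u i)
    refine (ae_restrict_iff' measurableSet_Icc).2 ?_
    filter_upwards [h1, h2, Measure.ae_ne volume b] with t ht1 ht2 htb ht
    rw [concat_eventually (fun v => v.u i.castSucc) htb, concat_eventually (fun v => v.x) htb]
    rcases lt_or_gt_of_ne htb with hlt | hlt
    · simp only [if_pos hlt.le]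
      exact ht1 ⟨ht.1, hlt.le⟩
    · simp only [if_neg (not_le_of_gt hlt)]
      exact ht2 ⟨hlt.le, ht.2⟩

theorem length_concat {γ η : ℝ → JetSpace n} {a b c : ℝ} :
    length (fun t => if t ≤ b then γ t else η t) a c ≤ length γ a b + length η b c := by
  refine (lintegral_mono_set (fun t ht => ?_ : Icc a c ⊆ Icc a b ∪ Icc b c)).trans
    ((lintegral_union_le _ _ _).trans (add_le_add (le_of_eq ?_) (le_of_eq ?_)))
  · rcases le_total t b with h | h
    · exact Or.inl ⟨ht.1, h⟩
    · exact Or.inr ⟨h, ht.2⟩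
  · refine lintegral_congr_ae ?_
    filter_upwards [ae_restrict_mem measurableSet_Icc, Measure.ae_ne (volume.restrict _) b]
      with t ht htb
    rw [concat_eventually (fun v => v.u (Fin.last n)) htb, concat_eventually (fun v => v.x) htb,
      if_pos ht.2, if_pos ht.2]
  · refine lintegral_congr_ae ?_
    filter_upwards [ae_restrict_mem measurableSet_Icc, Measure.ae_ne (volume.restrict _) b]
      with t ht htb
    have : ¬ t ≤ b := not_le_of_gt (lt_of_le_of_ne ht.1 htb.symm)
    rw [concat_eventually (fun v => v.u (Fin.last n)) htb, concat_eventually (fun v => v.x) htb,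
      if_neg this, if_neg this]

theorem dCC_triangle (u v w : JetSpace n) : dCC u w ≤ dCC u v + dCC v w := by
  refine ENNReal.le_of_forall_pos_le_add fun ε hε hfin => ?_
  have hε2 : (ε : ℝ≥0∞) / 2 ≠ 0 := by simpa using hε.ne'
  have h1 := ENNReal.lt_add_right (ne_top_of_le_ne_top hfin.ne le_self_add) hε2
  have h2 := ENNReal.lt_add_right (ne_top_of_le_ne_top hfin.ne le_add_self) hε2
  simp only [dCC, iInf_lt_iff] at h1 h2
  obtain ⟨a, b, γ, ⟨hab, hγ, ha, hb⟩, hl⟩ := h1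
  obtain ⟨c, d, η, ⟨hcd, hη, hc, hd⟩, hl'⟩ := h2
  rw [← length_shift η c d (c - b)] at hl'
  have hη' := hη.shift (c - b)
  rw [sub_sub_cancel] at hl' hη'
  set η' := fun t => η (t + (c - b))
  have hb' : η' b = v := by simp [η', hc]
  have hd' : η' (d - (c - b)) = w := by simp [η', hd]
  have hle : b ≤ d - (c - b) := by linarith
  refine (dCC_le (hab.trans hle) (hγ.concat hab hle hη' (hb.trans hb'.symm)) ?_ ?_).trans
    (length_concat.trans ((add_le_add hl.le hl'.le).trans (le_of_eq ?_)))
  · rw [if_pos hab, ha]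
  · split_ifs with h
    · have : d - (c - b) = b := le_antisymm h hle
      rw [this] at hd' ⊢
      rw [hb, ← hb', hd']
    · exact hd'
  · change dCC u v + (ε : ℝ≥0∞) / 2 + (dCC v w + (ε : ℝ≥0∞) / 2) = _
    rw [add_add_add_comm, ENNReal.add_halves]

/-- The jet space with its Carnot–Carathéodory distance. -/
noncomputable instance : PseudoEMetricSpace (JetSpace n) where
  edist := dCC
  edist_self := dCC_self
  edist_comm v w := le_antisymm (dCC_comm_le w v) (dCC_comm_le v w)
  edist_triangle := dCC_triangle

/-- The set `B_N(R)` of the points of `N` at distance at most `R` from the origin. -/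
def ballIn (N : Set (JetSpace n)) (R : ℝ) : Set (JetSpace n) :=
  {v ∈ N | edist 0 v ≤ ENNReal.ofReal R}

end JetSpace

/-! Write n = r - 1, q_i = 2^(m+i) for i < m, and a = 1/√m. On every interval of length K q_i with
endpoints in K q_i ℤ put the bump b(y) = (y(1-y))^(n+1), rescaled to the interval and multiplied by
a (q_i K)^(n+1) and by a fair random sign. The chain is the jet at Kτ of the sum of all these bumps,
for 0 ≤ τ ≤ 4^m.

Steps are short. At every scale the (n+1)-st derivative of a bump has size O(a), so that of the sum
is a random-sign sum of m terms of size O(m^(-1/2)), hence subgaussian with variance O(1). A step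
has length at most K(1 + |derivative|), so its p-th moment is O(K^p), and the right side of the
Markov inequality is O(4^m K^p) (`tsum_expectedDistPow_stepLaw_le`).

Branches separate. For 2^k = q_i the sign at scale i is redrawn between t - 2^k and t, so it differs
in the two branches with probability 1/2. In the middle half of the interval this typically
separates the u_0-coordinates by order a (q_i K)^(n+1). As x is the same in both, the distance is of
order a^(1/r) q_i K (`ofReal_abs_sub_u_le`). Dividing by q_i^p and summing over t and the m scales
gives order m 4^m (m^(-1/(2r)) K)^p (`le_tsum_expectedDistPow_pairLaw`). Comparison yields Π_p ≥ c
m^(1/p - 1/(2r)) (`le_of_markovConvexWith`).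

Rounding to N costs at most K per point. This is harmless for steps, which have order K anyway, and
for separations, because the scales start at 2^m. The chain stays at distance O(K 8^m) from 0, so m
may be a multiple of log R once K ≤ √R. The bound obtained has no log log R; that factor only
weakens it. Bounded R, and p > 2r where the exponent is negative, need only Π_p ≥ 1, which holds for
any two points at finite positive distance. -/

/-! ### Lower bounds for the Carnot–Carathéodory distance -/

namespace JetSpace

variable {n : ℕ}

/-- The polynomial `∑ j ≤ k, c (k - j) y ^ j / j!`. -/
noncomputable def taylorSum (c : ℕ → ℝ) (k : ℕ) (y : ℝ) : ℝ :=
  ∑ j ∈ Finset.range (k + 1), c (k - j) / (j.factorial : ℝ) * y ^ j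

theorem taylorSum_zero_right (c : ℕ → ℝ) (k : ℕ) : taylorSum c k 0 = c k := by
  simp [taylorSum, Finset.sum_range_succ']

theorem taylorSum_zero_left (c : ℕ → ℝ) (y : ℝ) : taylorSum c 0 y = c 0 := by
  simp [taylorSum]

theorem hasDerivAt_taylorSum (c : ℕ → ℝ) (k : ℕ) (y : ℝ) :
    HasDerivAt (taylorSum c (k + 1)) (taylorSum c k y) y := by
  have h : HasDerivAt (fun y : ℝ => ∑ j ∈ Finset.range (k + 1 + 1),
      c (k + 1 - j) / (j.factorial : ℝ) * y ^ j) (∑ j ∈ Finset.range (k + 1 + 1),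
      c (k + 1 - j) / (j.factorial : ℝ) * (j * y ^ (j - 1))) y :=
    HasDerivAt.fun_sum fun j _ => (hasDerivAt_pow j y).const_mul _
  refine h.congr_deriv ?_
  rw [Finset.sum_range_succ' _ (k + 1), taylorSum]
  simp only [CharP.cast_eq_zero, zero_mul, mul_zero, add_zero]
  refine Finset.sum_congr rfl fun j _ => ?_
  rw [Nat.add_sub_add_right, Nat.factorial_succ, Nat.add_sub_cancel]
  push_cast
  have : (j.factorial : ℝ) ≠ 0 := by positivity
  field_simp

theorem ac_const (c a b : ℝ) : AbsolutelyContinuousOnInterval (fun _ => c) a b :=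
  ((LipschitzWith.const c).lipschitzOnWith (s := uIcc a b)).absolutelyContinuousOnInterval

theorem ac_taylorSum {X : ℝ → ℝ} {a b : ℝ} (hX : AbsolutelyContinuousOnInterval X a b)
    (c : ℕ → ℝ) (k : ℕ) (x : ℝ) :
    AbsolutelyContinuousOnInterval (fun t => taylorSum c k (X t - x)) a b := by
  have hpow : ∀ j : ℕ, AbsolutelyContinuousOnInterval (fun t => (X t - x) ^ j) a b := by
    intro j
    induction j with
    | zero => simpa using ac_const 1 a b
    | succ j ih =>
      simp only [pow_succ]
      exact ih.mul (hX.sub (ac_const x a b))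
  unfold taylorSum
  induction Finset.range (k + 1) using Finset.induction_on with
  | empty => simpa using ac_const 0 a b
  | insert j s hj ih =>
    simp only [Finset.sum_insert hj]
    exact ((hpow j).const_mul _).add ih

theorem abs_le_of_abs_deriv_le {f ρ : ℝ → ℝ} {a b B t : ℝ}
    (hf : AbsolutelyContinuousOnInterval f a b) (ha : f a = 0) (hB : 0 ≤ B) (hρ : ∀ s, 0 ≤ ρ s)
    (hi : IntervalIntegrable ρ volume a b)
    (hd : ∀ᵐ s ∂volume.restrict (Icc a b), |deriv f s| ≤ B * ρ s) (ht : t ∈ Icc a b) :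
    |f t| ≤ B * ∫ s in a..b, ρ s := by
  have hab := ht.1.trans ht.2
  have h1 := ac_integral hf (t := t) (by rwa [uIcc_of_le hab])
  rw [ha, sub_zero] at h1
  have hi' : IntervalIntegrable ρ volume a t :=
    hi.mono_set (by rw [uIcc_of_le ht.1, uIcc_of_le hab]; exact Icc_subset_Icc_right ht.2)
  have hle : |∫ s in a..t, deriv f s| ≤ ∫ s in a..t, B * ρ s := by
    rw [← Real.norm_eq_abs]
    refine intervalIntegral.norm_integral_le_of_norm_le ht.1 ?_ (hi'.const_mul B)
    have := (ae_restrict_iff' measurableSet_Icc).1 hd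
    filter_upwards [this] with s hs hst
    exact hs ⟨hst.1.le, hst.2.trans ht.2⟩
  rw [h1, intervalIntegral.integral_const_mul] at hle
  refine hle.trans (mul_le_mul_of_nonneg_left ?_ hB)
  exact intervalIntegral.integral_mono_interval le_rfl ht.1 ht.2
    (Filter.Eventually.of_forall hρ) hi

/-- Here `V k` stands for the coordinate u_(n-k). The Taylor polynomials in `X - X a` obey the same
relation P_(k+1)' = P_k X' with the same initial values, so the error at level k + 1 has derivative
X' times the error at level k. Each integration gains one factor of the length. -/
theorem abs_sub_taylorSum_le {a b : ℝ} (hab : a ≤ b) {X ρ : ℝ → ℝ}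
    (hX : AbsolutelyContinuousOnInterval X a b) (hρ : ∀ s, 0 ≤ ρ s)
    (hi : IntervalIntegrable ρ volume a b) (hXρ : ∀ t, |deriv X t| ≤ ρ t) {V : ℕ → ℝ → ℝ} {N : ℕ}
    (hV : ∀ k ≤ N, AbsolutelyContinuousOnInterval (V k) a b) (h0 : ∀ t, |deriv (V 0) t| ≤ ρ t)
    (hs : ∀ k < N, ∀ᵐ t ∂volume.restrict (Icc a b), deriv (V (k + 1)) t = V k t * deriv X t) :
    ∀ k ≤ N, ∀ t ∈ Icc a b,
      |V k t - taylorSum (fun j => V j a) k (X t - X a)| ≤ (∫ s in a..b, ρ s) ^ (k + 1) := by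
  have hℓ : 0 ≤ ∫ s in a..b, ρ s := intervalIntegral.integral_nonneg hab fun s _ => hρ s
  intro k
  induction k with
  | zero =>
    intro _ t ht
    simp only [taylorSum_zero_left]
    have := abs_le_of_abs_deriv_le (f := fun t => V 0 t - V 0 a) (B := 1)
      ((hV 0 (Nat.zero_le _)).sub (ac_const _ a b)) (sub_self _) zero_le_one hρ hi
      (Filter.Eventually.of_forall fun s => by simpa using h0 s) ht
    simpa using this
  | succ k ih =>
    intro hk t ht
    have hk' := ih (by omega)
    have hac : AbsolutelyContinuousOnInterval
        (fun t => V (k + 1) t - taylorSum (fun j => V j a) (k + 1) (X t - X a)) a b :=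
      (hV _ hk).sub (ac_taylorSum hX _ _ _)
    have hd1 : ∀ᵐ s ∂volume.restrict (Icc a b), DifferentiableAt ℝ X s := by
      refine (ae_restrict_iff' measurableSet_Icc).2 ?_
      have := hX.ae_differentiableAt
      rwa [uIcc_of_le hab] at this
    have hd2 : ∀ᵐ s ∂volume.restrict (Icc a b), DifferentiableAt ℝ (V (k + 1)) s := by
      refine (ae_restrict_iff' measurableSet_Icc).2 ?_
      have := (hV _ hk).ae_differentiableAt
      rwa [uIcc_of_le hab] at this
    rw [pow_succ]
    refine abs_le_of_abs_deriv_le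
      (f := fun t => V (k + 1) t - taylorSum (fun j => V j a) (k + 1) (X t - X a)) hac
      (by simp [taylorSum_zero_right]) (pow_nonneg hℓ _) hρ hi ?_ ht
    filter_upwards [hd1, hd2, hs k (by omega), ae_restrict_mem measurableSet_Icc]
      with s hs1 hs2 hs3 hsm
    have hc : HasDerivAt (fun t => taylorSum (fun j => V j a) (k + 1) (X t - X a))
        (taylorSum (fun j => V j a) k (X s - X a) * deriv X s) s :=
      (hasDerivAt_taylorSum _ _ _).comp s (hs1.hasDerivAt.sub_const (X a))
    rw [(hs2.hasDerivAt.fun_sub hc).deriv, hs3, ← sub_mul, abs_mul]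
    exact mul_le_mul (hk' s hsm) (hXρ s) (abs_nonneg _) (pow_nonneg hℓ _)

/-- The speed of a horizontal curve. -/
noncomputable def speed (γ : ℝ → JetSpace n) (t : ℝ) : ℝ :=
  √(deriv (fun s => (γ s).x) t ^ 2 + deriv (fun s => (γ s).u (Fin.last n)) t ^ 2)

theorem speed_nonneg (γ : ℝ → JetSpace n) (t : ℝ) : 0 ≤ speed γ t := Real.sqrt_nonneg _

theorem IsHorizontal.intervalIntegrable_speed {γ : ℝ → JetSpace n} {a b : ℝ}
    (h : IsHorizontal γ a b) : IntervalIntegrable (speed γ) volume a b := by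
  have h1 := h.ac_x.intervalIntegrable_deriv
  have h2 := (h.ac_u (Fin.last n)).intervalIntegrable_deriv
  refine (h1.abs.add h2.abs).mono_fun ?_ ?_
  · refine Measurable.aestronglyMeasurable ?_
    exact (((measurable_deriv _).pow_const 2).add ((measurable_deriv _).pow_const 2)).sqrt
  · refine Filter.Eventually.of_forall fun t => ?_
    simp only [speed]
    rw [Real.norm_of_nonneg (Real.sqrt_nonneg _), Real.norm_of_nonneg (by positivity)]
    refine Real.sqrt_le_iff.2 ⟨by positivity, ?_⟩
    rw [add_sq, sq_abs, sq_abs]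
    nlinarith [mul_nonneg (abs_nonneg (deriv (fun s => (γ s).x) t))
      (abs_nonneg (deriv (fun s => (γ s).u (Fin.last n)) t))]

theorem IsHorizontal.length_eq {γ : ℝ → JetSpace n} {a b : ℝ} (hab : a ≤ b)
    (h : IsHorizontal γ a b) : length γ a b = ENNReal.ofReal (∫ t in a..b, speed γ t) := by
  have hi := h.intervalIntegrable_speed
  rw [intervalIntegrable_iff_integrableOn_Icc_of_le hab] at hi
  rw [intervalIntegral.integral_of_le hab, ← integral_Icc_eq_integral_Ioc,
    ofReal_integral_eq_lintegral_ofReal hi (Filter.Eventually.of_forall fun t => Real.sqrt_nonneg _)]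
  rfl

theorem abs_deriv_x_le_speed (γ : ℝ → JetSpace n) (t : ℝ) :
    |deriv (fun s => (γ s).x) t| ≤ speed γ t :=
  Real.abs_le_sqrt (le_add_of_nonneg_right (sq_nonneg _))

theorem abs_deriv_u_le_speed (γ : ℝ → JetSpace n) (t : ℝ) :
    |deriv (fun s => (γ s).u (Fin.last n)) t| ≤ speed γ t :=
  Real.abs_le_sqrt (le_add_of_nonneg_left (sq_nonneg _))

theorem ofReal_abs_sub_x_le (v w : JetSpace n) : ENNReal.ofReal |v.x - w.x| ≤ edist v w := by
  refine le_iInf fun a => le_iInf fun b => le_iInf fun γ => le_iInf fun ⟨hab, h, ha, hb⟩ => ?_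
  rw [h.length_eq hab, abs_sub_comm, ← ha, ← hb]
  refine ENNReal.ofReal_le_ofReal ?_
  have := abs_le_of_abs_deriv_le (f := fun t => (γ t).x - (γ a).x) (B := 1)
      (h.ac_x.sub (ac_const _ a b)) (sub_self _) zero_le_one (speed_nonneg γ)
      h.intervalIntegrable_speed
      (Filter.Eventually.of_forall fun s => by simpa using abs_deriv_x_le_speed γ s)
      (right_mem_Icc.2 hab)
  simpa using this

theorem IsHorizontal.abs_u_sub_taylorSum_le {γ : ℝ → JetSpace n} {a b : ℝ} (hab : a ≤ b)
    (h : IsHorizontal γ a b) {ι : ℕ → Fin (n + 1)} (hι : ∀ k, (ι k : ℕ) = n - k) (k : ℕ)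
    (hk : k ≤ n) :
    |(γ b).u (ι k) - taylorSum (fun j => (γ a).u (ι j)) k ((γ b).x - (γ a).x)| ≤
      (∫ s in a..b, speed γ s) ^ (k + 1) := by
  have hd : ∀ k < n, ∀ᵐ t ∂volume.restrict (Icc a b),
      deriv (fun t => (γ t).u (ι (k + 1))) t = (γ t).u (ι k) * deriv (fun t => (γ t).x) t := by
    intro k hk
    have e1 : (⟨n - (k + 1), by omega⟩ : Fin n).succ = ι k := by
      apply Fin.ext
      rw [hι, Fin.val_succ]
      change n - (k + 1) + 1 = n - k
      omega
    have e2 : (⟨n - (k + 1), by omega⟩ : Fin n).castSucc = ι (k + 1) := by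
      apply Fin.ext
      rw [hι, Fin.val_castSucc]
    rw [← e1, ← e2]
    exact h.deriv_u _
  have h0 : ι 0 = Fin.last n := Fin.ext (by rw [hι]; rfl)
  exact abs_sub_taylorSum_le (X := fun t => (γ t).x) (V := fun k t => (γ t).u (ι k))
    (N := n) hab h.ac_x (speed_nonneg γ) h.intervalIntegrable_speed (abs_deriv_x_le_speed γ)
    (fun k _ => h.ac_u _) (by rw [h0]; exact abs_deriv_u_le_speed γ) hd k hk b
    (right_mem_Icc.2 hab)

/-- If a curve returns to its initial `x`, the Taylor polynomial is reduced to its constant term,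
and `u i` moves by at most the power of the length given by its homogeneous weight. The case i = 0
separates the branches of the chain. -/
theorem ofReal_abs_sub_u_le {v w : JetSpace n} (hx : v.x = w.x) (i : Fin (n + 1)) :
    ENNReal.ofReal |v.u i - w.u i| ≤ edist v w ^ (n + 1 - (i : ℕ)) := by
  have key : ∀ d, dCC v w < d → ENNReal.ofReal |v.u i - w.u i| ≤ d ^ (n + 1 - (i : ℕ)) := by
    intro d hd
    simp only [dCC, iInf_lt_iff] at hd
    obtain ⟨a, b, γ, ⟨hab, h, ha, hb⟩, hl⟩ := hd
    refine le_trans ?_ (pow_le_pow_left' hl.le _)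
    have hℓ : 0 ≤ ∫ s in a..b, speed γ s :=
      intervalIntegral.integral_nonneg hab fun s _ => speed_nonneg γ s
    rw [h.length_eq hab, ← ENNReal.ofReal_pow hℓ]
    refine ENNReal.ofReal_le_ofReal ?_
    have := h.abs_u_sub_taylorSum_le hab (ι := fun k => ⟨n - k, by omega⟩) (fun _ => rfl) (n - i)
      (Nat.sub_le _ _)
    have e1 : (⟨n - (n - (i : ℕ)), by omega⟩ : Fin (n + 1)) = i := by ext; simp; omega
    have e2 : n - (i : ℕ) + 1 = n + 1 - i := by omega
    have e3 : (γ b).x - (γ a).x = 0 := by rw [ha, hb, hx, sub_self]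
    rw [e3, taylorSum_zero_right, e1, e2, ha, hb, abs_sub_comm] at this
    exact this
  by_cases hfin : dCC v w = ⊤
  · change _ ≤ dCC v w ^ _
    rw [hfin, ENNReal.top_pow (by omega)]
    exact le_top
  -- The bound holds for every `d` above the infimum; let `d` decrease to it.
  · have : (nhdsWithin (dCC v w) (Ioi (dCC v w))).NeBot :=
      nhdsGT_neBot_of_exists_gt ⟨⊤, Ne.lt_top hfin⟩
    refine ge_of_tendsto (x := nhdsWithin (dCC v w) (Ioi (dCC v w)))
      (f := fun d => d ^ (n + 1 - (i : ℕ))) ?_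
      (eventually_nhdsWithin_of_forall fun d hd => key d hd)
    exact ((ENNReal.continuous_pow _).tendsto _).mono_left nhdsWithin_le_nhds

theorem eq_of_edist_eq_zero {v w : JetSpace n} (h : edist v w = 0) : v = w := by
  have hx : v.x = w.x := by
    have := ofReal_abs_sub_x_le v w
    rw [h, nonpos_iff_eq_zero, ENNReal.ofReal_eq_zero] at this
    exact sub_eq_zero.1 (abs_nonpos_iff.1 this)
  ext i
  · exact hx
  · have := ofReal_abs_sub_u_le hx i
    rw [h, zero_pow (by omega), nonpos_iff_eq_zero, ENNReal.ofReal_eq_zero] at this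
    exact sub_eq_zero.1 (abs_nonpos_iff.1 this)

/-! ### Upper bounds for the Carnot–Carathéodory distance -/

/-- The jet at `x` of a function with successive derivatives `U 0, U 1, …`. -/
def jetOf (U : ℕ → ℝ → ℝ) (x : ℝ) : JetSpace n := ⟨x, fun i => U i x⟩

/-- The jet curve is itself horizontal, with speed √(1 + U_(n+1)²) ≤ 1 + M. -/
theorem edist_jetOf_le {U : ℕ → ℝ → ℝ} (hU : ∀ j ≤ n, ∀ x, HasDerivAt (U j) (U (j + 1) x) x)
    {a b M : ℝ} (hab : a ≤ b) (hM0 : 0 ≤ M) (hM : ∀ x ∈ Icc a b, |U (n + 1) x| ≤ M)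
    (hc : Continuous (U (n + 1))) :
    edist (jetOf U a : JetSpace n) (jetOf U b) ≤ ENNReal.ofReal ((b - a) * (1 + M)) := by
  have hcont : ∀ j ≤ n + 1, Continuous (U j) := by
    intro j hj
    rcases Nat.lt_or_ge n j with h | h
    · obtain rfl : j = n + 1 := by omega
      exact hc
    · exact continuous_iff_continuousAt.2 fun x => (hU j h x).continuousAt
  have hder : ∀ j ≤ n, deriv (U j) = U (j + 1) := fun j hj => funext fun x => (hU j hj x).deriv
  have hC1 : ∀ j ≤ n, ContDiff ℝ 1 (U j) := fun j hj => by
    rw [contDiff_one_iff_deriv]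
    exact ⟨fun x => (hU j hj x).differentiableAt, by rw [hder j hj]; exact hcont _ (by omega)⟩
  have hh : IsHorizontal (jetOf U : ℝ → JetSpace n) a b :=
    { ac_x := contDiff_id.contDiffOn.absolutelyContinuousOnInterval
      ac_u := fun i => (hC1 i (by omega)).contDiffOn.absolutelyContinuousOnInterval
      deriv_u := fun i => Filter.Eventually.of_forall fun t => by
        simp only [jetOf, deriv_id'', mul_one, Fin.val_castSucc, Fin.val_succ]
        rw [show (fun s => U (i : ℕ) s) = U i from rfl, hder _ (by omega)] }
  refine (dCC_le hab hh rfl rfl).trans ?_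
  rw [hh.length_eq hab]
  refine ENNReal.ofReal_le_ofReal ?_
  have := intervalIntegral.integral_mono_on hab hh.intervalIntegrable_speed
    (intervalIntegrable_const (c := 1 + M)) fun t ht => by
      simp only [speed, jetOf, deriv_id'', Fin.val_last]
      rw [show (fun s => U n s) = U n from rfl, hder n le_rfl]
      refine Real.sqrt_le_iff.2 ⟨by positivity, ?_⟩
      have := sq_le_sq' (by linarith [neg_le_of_abs_le (hM t ht)]) (le_of_abs_le (hM t ht))
      nlinarith
  rwa [intervalIntegral.integral_const, smul_eq_mul] at this

end JetSpace

/-! ### Expectations with respect to discrete distributions -/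

/-- The expectation of a nonnegative function with respect to a discrete distribution. -/
noncomputable def expectation {α : Type*} (ν : PMF α) (g : α → ℝ≥0∞) : ℝ≥0∞ := ∑' z, ν z * g z

section expectation

variable {α β : Type*}

theorem expectation_bind (ν : PMF α) (κ : α → PMF β) (g : β → ℝ≥0∞) :
    expectation (ν.bind κ) g = expectation ν fun a => expectation (κ a) g := by
  simp only [expectation, PMF.bind_apply, ← ENNReal.tsum_mul_right, ← ENNReal.tsum_mul_left]
  rw [ENNReal.tsum_comm]
  simp only [mul_assoc]

theorem expectation_pure (a : α) (g : α → ℝ≥0∞) : expectation (PMF.pure a) g = g a := by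
  classical
  rw [expectation, tsum_eq_single a fun b hb => by simp [PMF.pure_apply, hb]]
  simp

theorem expectation_map (ν : PMF α) (h : α → β) (g : β → ℝ≥0∞) :
    expectation (ν.map h) g = expectation ν fun a => g (h a) := by
  rw [PMF.map, expectation_bind]
  simp only [Function.comp_apply, expectation_pure]

theorem expectation_const (ν : PMF α) (c : ℝ≥0∞) : expectation ν (fun _ => c) = c := by
  rw [expectation, ENNReal.tsum_mul_right, ν.tsum_coe, one_mul]

theorem expectation_mono {ν : PMF α} {g h : α → ℝ≥0∞} (H : ∀ a, g a ≤ h a) :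
    expectation ν g ≤ expectation ν h :=
  ENNReal.tsum_le_tsum fun a => mul_le_mul_right (H a) _

theorem expectation_add (ν : PMF α) (g h : α → ℝ≥0∞) :
    expectation ν (fun a => g a + h a) = expectation ν g + expectation ν h := by
  simp only [expectation, mul_add, ENNReal.tsum_add]

theorem expectation_comm (ν : PMF α) (μ : PMF β) (g : α → β → ℝ≥0∞) :
    expectation ν (fun a => expectation μ (g a)) =
      expectation μ fun b => expectation ν fun a => g a b := by
  simp only [expectation, ← ENNReal.tsum_mul_left]
  rw [ENNReal.tsum_comm]
  simp only [mul_left_comm]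

theorem ext_expectation {ν μ : PMF α} (h : ∀ g, expectation ν g = expectation μ g) : ν = μ := by
  classical
  have key : ∀ (ξ : PMF α) a, expectation ξ (fun b => if b = a then 1 else 0) = ξ a := by
    intro ξ a
    rw [expectation, tsum_eq_single a fun b hb => by simp [hb]]
    simp
  ext a
  rw [← key ν, ← key μ, h]

theorem expectation_uniform [Fintype α] [Nonempty α] (g : α → ℝ≥0∞) :
    expectation (PMF.uniformOfFintype α) g = (Fintype.card α : ℝ≥0∞)⁻¹ * ∑ a, g a := by
  rw [expectation, tsum_fintype, Finset.mul_sum]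
  simp only [PMF.uniformOfFintype_apply]

theorem expectation_uniform_equiv [Fintype α] [Nonempty α] (e : α ≃ α) (g : α → ℝ≥0∞) :
    (expectation (PMF.uniformOfFintype α) fun a => g (e a)) =
      expectation (PMF.uniformOfFintype α) g := by
  rw [expectation_uniform, expectation_uniform, Equiv.sum_comp e g]

end expectation

/-! ### Spaces with two points -/

/-- The chain rests at `a`, tosses a fair coin between `a` and `b` at a single step, and rests
again. That step contributes D/2 on the right, and the term k = 0, t = 1 (two independent tosses)
already contributes D/2 on the left. -/
theorem one_le_markovConvexityConst {p : ℝ} (hp : 0 < p) {M : Type*} [PseudoEMetricSpace M]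
    {a b : M} (h0 : edist a b ≠ 0) (ht : edist a b ≠ ⊤) : 1 ≤ markovConvexityConst p M := by
  classical
  refine le_iInf fun C => le_iInf fun hC => ?_
  let U : PMF Bool := PMF.uniformOfFintype Bool
  let X : MarkovChain Bool :=
    { law := fun t => if t ≤ 0 then PMF.pure false else U
      trans := fun t x => if t = 0 then U else PMF.pure x
      law_succ := fun t => by
        rcases lt_trichotomy t 0 with h | h | h
        · have h1 : t + 1 ≤ 0 := by omega
          simp [h1, h.le, h.ne]
        · subst h
          simp
        · have h1 : ¬ t + 1 ≤ 0 := by omega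
          have h2 : ¬ t ≤ 0 := by omega
          simp only [h1, h2, h.ne', if_false]
          exact (PMF.bind_pure U).symm }
  let f : Bool → M := fun x => if x then b else a
  set D := edist a b ^ p with hD
  have hff : ∀ x, edist (f x) (f x) ^ p = 0 := fun x => by
    rw [edist_self, ENNReal.zero_rpow_of_pos hp]
  have hab : edist (f true) (f false) ^ p = D := by simp [f, hD, edist_comm]
  have hba : edist (f false) (f true) ^ p = D := by simp [f, hD]
  have hstep : ∀ t : ℤ, t ≠ 0 → expectedDistPow p f (X.stepLaw t) = 0 := by
    intro t h
    change expectation _ _ = 0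
    rw [MarkovChain.stepLaw, expectation_bind]
    simp only [expectation_map, X, h, if_false, expectation_pure, hff, expectation_const]
  have hstep0 : expectedDistPow p f (X.stepLaw 0) = 2⁻¹ * D := by
    change expectation _ _ = _
    rw [MarkovChain.stepLaw, expectation_bind]
    simp only [expectation_map, X, if_true, le_refl, expectation_pure, U, expectation_uniform,
      Fintype.card_bool, Fintype.sum_bool, hff, hba]
    simp
  have hpair : expectedDistPow p f (X.pairLaw 1 (1 - 2 ^ 0)) = 2⁻¹ * D := by
    change expectation _ _ = _
    have : X.pairLaw 1 (1 - 2 ^ 0) = X.branchLaw 0 1 := by simp [MarkovChain.pairLaw]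
    rw [this, MarkovChain.branchLaw, MarkovChain.branchLaw]
    simp only [expectation_bind, expectation_map, X, if_true, le_refl, expectation_pure, U,
      expectation_uniform, Nat.cast_zero, add_zero,
      Fintype.card_bool, Fintype.sum_bool, hff, hba, hab, zero_add]
    rw [← two_mul, ← mul_assoc, Nat.cast_ofNat, ← mul_assoc,
      mul_assoc (2⁻¹ : ℝ≥0∞) 2, ENNReal.mul_inv_cancel (by simp) (by simp), mul_one]
  have h := hC Bool X f
  rw [tsum_eq_single 0 hstep, hstep0] at h
  have h1 : 2⁻¹ * D ≤ ∑' k : ℕ, ∑' t : ℤ,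
      expectedDistPow p f (X.pairLaw t (t - 2 ^ k)) / (2 : ℝ≥0∞) ^ ((k : ℝ) * p) := by
    refine le_trans ?_ (ENNReal.le_tsum 0)
    refine le_trans ?_ (ENNReal.le_tsum 1)
    rw [hpair]
    simp
  have h2 := h1.trans h
  have hD0 : 2⁻¹ * D ≠ 0 := by
    refine mul_ne_zero (by simp) ?_
    rw [hD, Ne, ENNReal.rpow_eq_zero_iff]
    rintro (h | h)
    · exact h0 h.1
    · exact ht h.1
  have hDt : 2⁻¹ * D ≠ ⊤ := ENNReal.mul_ne_top (by simp) (ENNReal.rpow_ne_top_of_nonneg hp.le ht)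
  by_contra! hlt
  have h3 : (C : ℝ≥0∞) ^ p < 1 := ENNReal.rpow_lt_one hlt hp
  have h4 := ENNReal.mul_lt_mul_left hD0 hDt h3
  rw [one_mul] at h4
  exact absurd h2 (not_le_of_gt h4)

/-! ### Chains that refresh independent fair bits -/

section refresh

open Classical in
/-- The bits `ε`, with those at the places in `A` replaced by the bits `η`. -/
noncomputable def mix {ι : Type} (A : ι → Prop) (ε η : ι → Bool) : ι → Bool :=
  fun i => if A i then η i else ε i

theorem mix_apply_of {ι : Type} {A : ι → Prop} {i : ι} (h : A i) (ε η : ι → Bool) :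
    mix A ε η i = η i :=
  if_pos h

theorem mix_apply_of_not {ι : Type} {A : ι → Prop} {i : ι} (h : ¬ A i) (ε η : ι → Bool) :
    mix A ε η i = ε i :=
  if_neg h

/-- The bits `ε` with the one at `k` reversed. -/
def flipBit {ι : Type} [DecidableEq ι] (k : ι) (ε : ι → Bool) : ι → Bool := Function.update ε k (!ε k)

theorem flipBit_apply_self {ι : Type} [DecidableEq ι] (k : ι) (ε : ι → Bool) : flipBit k ε k = !ε k := by simp [flipBit]

theorem flipBit_apply_of_ne {ι : Type} [DecidableEq ι] {k i : ι} (h : i ≠ k) (ε : ι → Bool) : flipBit k ε i = ε i := by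
  simp [flipBit, h]

theorem flipBit_involutive {ι : Type} [DecidableEq ι] (k : ι) : Function.Involutive (flipBit k) := by
  intro ε
  ext i
  by_cases h : i = k
  · subst h
    simp [flipBit_apply_self]
  · simp [flipBit_apply_of_ne h]

/-! ### Means over independent fair bits -/

variable {ι : Type} [Fintype ι] [DecidableEq ι]

/-- The expectation of a function of independent fair bits. -/
noncomputable def bitMean (g : (ι → Bool) → ℝ≥0∞) : ℝ≥0∞ :=
  expectation (PMF.uniformOfFintype (ι → Bool)) g

theorem bitMean_eq (g : (ι → Bool) → ℝ≥0∞) :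
    bitMean g = (Fintype.card (ι → Bool) : ℝ≥0∞)⁻¹ * ∑ ε, g ε :=
  expectation_uniform g

/-- Exchanging `ε` and `η` at the places in `A` is an involution on pairs, hence preserves the
uniform law. This is the stationarity of the refreshed bits. -/
theorem bitMean_mix (A : ι → Prop) (g : (ι → Bool) → ℝ≥0∞) :
    (bitMean fun ε => bitMean fun η => g (mix A ε η)) = bitMean g := by
  classical
  let e : Equiv.Perm ((ι → Bool) × (ι → Bool)) :=
    Function.Involutive.toPerm (fun z => (mix A z.1 z.2, mix A z.2 z.1)) (by
      rintro ⟨ε, η⟩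
      ext i <;> by_cases h : A i <;> simp [mix, h])
  have h1 : ∑ ε, ∑ η, g (mix A ε η) = ∑ ε : ι → Bool, ∑ _η : ι → Bool, g ε := by
    rw [← Fintype.sum_prod_type', ← Fintype.sum_prod_type']
    exact Equiv.sum_comp e fun z => g z.1
  have h2 : (Fintype.card (ι → Bool) : ℝ≥0∞) ≠ 0 := by simp
  have h3 : (Fintype.card (ι → Bool) : ℝ≥0∞) ≠ ⊤ := ENNReal.natCast_ne_top _
  simp only [bitMean_eq]
  rw [← Finset.mul_sum, h1, Finset.sum_comm, Finset.sum_const, Finset.card_univ, nsmul_eq_mul,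
    ← mul_assoc (_⁻¹ : ℝ≥0∞) (Fintype.card _ : ℝ≥0∞), ENNReal.inv_mul_cancel h2 h3, one_mul]

theorem bitMean_comm (g : (ι → Bool) → (ι → Bool) → ℝ≥0∞) :
    (bitMean fun ε => bitMean fun η => g ε η) = bitMean fun η => bitMean fun ε => g ε η :=
  expectation_comm _ _ _

theorem bitMean_const (c : ℝ≥0∞) : bitMean (fun _ : ι → Bool => c) = c := expectation_const _ _

theorem bitMean_mono {g h : (ι → Bool) → ℝ≥0∞} (H : ∀ ε, g ε ≤ h ε) : bitMean g ≤ bitMean h :=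
  expectation_mono H

theorem bitMean_add (g h : (ι → Bool) → ℝ≥0∞) :
    (bitMean fun ε => g ε + h ε) = bitMean g + bitMean h :=
  expectation_add _ _ _

theorem bitMean_flipBit (k : ι) (g : (ι → Bool) → ℝ≥0∞) :
    (bitMean fun ε => g (flipBit k ε)) = bitMean g :=
  expectation_uniform_equiv (flipBit_involutive k).toPerm g

/-- Average over reversing bit `k` in neither, one or both of the strings. These four variants have
the same mean, and they form two pairs, in exactly one of which the strings differ at `k`. -/
theorem le_four_mul_bitMean (k : ι) {v : ℝ≥0∞} {h : (ι → Bool) → (ι → Bool) → ℝ≥0∞}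
    (H : ∀ ε η, ε k ≠ η k → v ≤ h ε η + h (flipBit k ε) (flipBit k η)) :
    v ≤ 4 * bitMean fun ε => bitMean fun η => h ε η := by
  set E := bitMean fun ε => bitMean fun η => h ε η with hE
  have e1 : (bitMean fun ε => bitMean fun η => h (flipBit k ε) (flipBit k η)) = E := by
    simp only [bitMean_flipBit k (h _)]
    exact bitMean_flipBit k fun ε => bitMean (h ε)
  have e2 : (bitMean fun ε => bitMean fun η => h (flipBit k ε) η) = E :=
    bitMean_flipBit k fun ε => bitMean (h ε)
  have e3 : (bitMean fun ε => bitMean fun η => h ε (flipBit k η)) = E := by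
    simp only [bitMean_flipBit k (h _), hE]
  calc v = bitMean fun _ : ι → Bool => bitMean fun _ : ι → Bool => v := by
        simp only [bitMean_const]
    _ ≤ bitMean fun ε => bitMean fun η => (h ε η + h (flipBit k ε) (flipBit k η)) +
          (h (flipBit k ε) η + h ε (flipBit k η)) := by
        refine bitMean_mono fun ε => bitMean_mono fun η => ?_
        by_cases hk : ε k = η k
        · have := H (flipBit k ε) η (by simp [flipBit_apply_self, hk])
          rw [flipBit_involutive k] at this
          exact this.trans le_add_self
        · exact (H ε η hk).trans le_self_add
    _ = 4 * E := by
        simp only [bitMean_add, e1, e2, e3, ← hE]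
        ring

/-- The chain of pairs (time, bits) in which the bits are independent and fair, and the bits at the
places in `A t` are drawn anew at time `t`. -/
noncomputable def refreshChain (A : ℤ → ι → Prop) : MarkovChain (ℤ × (ι → Bool)) where
  law t := (PMF.uniformOfFintype (ι → Bool)).map fun ε => (t, ε)
  trans t z := (PMF.uniformOfFintype (ι → Bool)).map fun η => (t + 1, mix (A (t + 1)) z.2 η)
  law_succ t := by
    refine ext_expectation fun g => ?_
    rw [expectation_bind]
    simp only [expectation_map]
    exact (bitMean_mix (A (t + 1)) fun ε => g (t + 1, ε)).symm

/-! ### Joint laws of the refresh chain -/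

variable (A : ℤ → ι → Prop)

theorem expectation_refreshChain_stepLaw (t : ℤ)
    (g : (ℤ × (ι → Bool)) × (ℤ × (ι → Bool)) → ℝ≥0∞) :
    expectation ((refreshChain A).stepLaw t) g = bitMean fun ε => bitMean fun η =>
      g ((t, ε), (t + 1, mix (A (t + 1)) ε η)) := by
  rw [MarkovChain.stepLaw, expectation_bind]
  simp only [refreshChain, expectation_map]
  rfl

theorem mix_mix {ι : Type} (B C D : ι → Prop) (h : ∀ i, D i ↔ B i ∨ C i) (ε η ε' η' : ι → Bool) :
    mix C (mix B ε η) η' = mix D (mix C ε ε') (mix C η η') := by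
  ext i
  by_cases hB : B i <;> by_cases hC : C i <;> simp [mix, hB, hC, h]

/-- A place refreshed after time `s` carries independent bits in the two branches; any other place
still carries the common bit. -/
theorem expectation_refreshChain_branchLaw (s : ℤ) (m : ℕ)
    (g : (ℤ × (ι → Bool)) × (ℤ × (ι → Bool)) → ℝ≥0∞) :
    expectation ((refreshChain A).branchLaw s m) g = bitMean fun ε => bitMean fun η =>
      g ((s + m, ε), (s + m, mix (fun i => ∃ u, s < u ∧ u ≤ s + m ∧ A u i) ε η)) := by
  induction m generalizing g with
  | zero =>
    rw [MarkovChain.branchLaw, expectation_map]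
    simp only [refreshChain, expectation_map]
    have h : ∀ ε η : ι → Bool,
        mix (fun i => ∃ u, s < u ∧ u ≤ s + ((0 : ℕ) : ℤ) ∧ A u i) ε η = ε := fun ε η => by
      ext i
      rw [mix_apply_of_not]
      rintro ⟨u, h1, h2, -⟩
      simp at h2
      omega
    simp only [h, bitMean_const]
    simp [bitMean]
  | succ m ih =>
    rw [MarkovChain.branchLaw, expectation_bind, ih]
    simp only [expectation_bind, refreshChain, expectation_map]
    have hmix := fun ε η ε' η' : ι → Bool => mix_mix (fun i => ∃ u, s < u ∧ u ≤ s + (m : ℤ) ∧ A u i)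
      (A (s + m + 1)) (fun i => ∃ u, s < u ∧ u ≤ s + ((m + 1 : ℕ) : ℤ) ∧ A u i) (fun i => by
        constructor
        · rintro ⟨u, h1, h2, h3⟩
          rcases eq_or_ne u (s + m + 1) with h | h
          · right
            rwa [h] at h3
          · left
            exact ⟨u, h1, by push_cast at h2; omega, h3⟩
        · rintro (⟨u, h1, h2, h3⟩ | h)
          · exact ⟨u, h1, by push_cast; omega, h3⟩
          · exact ⟨s + m + 1, by omega, by push_cast; omega, h⟩) ε η ε' η'
    have e : s + ((m + 1 : ℕ) : ℤ) = s + m + 1 := by push_cast; ring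
    set D : ι → Prop := fun i => ∃ u, s < u ∧ u ≤ s + ((m + 1 : ℕ) : ℤ) ∧ A u i
    rw [e]
    set C := A (s + m + 1)
    set H : (ι → Bool) → (ι → Bool) → ℝ≥0∞ := fun x y => g ((s + m + 1, x), (s + m + 1, mix D x y))
      with hH
    change (bitMean fun ε => bitMean fun η => bitMean fun ε' => bitMean fun η' =>
      g ((s + m + 1, mix C ε ε'), (s + m + 1, mix C (mix _ ε η) η'))) = bitMean fun ε => bitMean fun η => H ε η
    -- By `mix_mix` the integrand depends only on the strings `mix C ε ε'` and `mix C η η'`, and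
    -- `bitMean_mix` replaces each of them by one uniform string.
    have h1 : ∀ ε η ε' η' : ι → Bool, g ((s + m + 1, mix C ε ε'), (s + m + 1,
        mix C (mix (fun i => ∃ u, s < u ∧ u ≤ s + (m : ℤ) ∧ A u i) ε η) η')) =
        H (mix C ε ε') (mix C η η') := fun ε η ε' η' => by rw [hmix ε η ε' η']
    simp only [h1]
    have h2 : ∀ ε : ι → Bool, (bitMean fun η => bitMean fun ε' => bitMean fun η' =>
        H (mix C ε ε') (mix C η η')) = bitMean fun ε' => bitMean (H (mix C ε ε')) := fun ε => by
      rw [bitMean_comm]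
      simp only [bitMean_mix C (H _)]
    simp only [h2]
    exact bitMean_mix C fun x => bitMean (H x)

theorem expectation_refreshChain_pairLaw (t : ℤ) (k : ℕ)
    (g : (ℤ × (ι → Bool)) × (ℤ × (ι → Bool)) → ℝ≥0∞) :
    expectation ((refreshChain A).pairLaw t (t - 2 ^ k)) g = bitMean fun ε => bitMean fun η =>
      g ((t, ε), (t, mix (fun i => ∃ u, t - 2 ^ k < u ∧ u ≤ t ∧ A u i) ε η)) := by
  have h2 : (0 : ℤ) < 2 ^ k := by positivity
  rw [MarkovChain.pairLaw, if_neg (by omega), expectation_refreshChain_branchLaw]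
  have : t - 2 ^ k + (((t - (t - 2 ^ k)).toNat : ℕ) : ℤ) = t := by
    rw [Int.toNat_of_nonneg (by omega)]
    ring
  rw [this]

/-! ### Exponential moments of random signs -/

/-- The sign of a bit. -/
def bitSign (b : Bool) : ℝ := if b then 1 else -1

theorem abs_bitSign (b : Bool) : |bitSign b| = 1 := by cases b <;> simp [bitSign]

/-- Independence factors the sum into ∏ 2 cosh(b_i), and cosh x ≤ exp(x²/2). -/
theorem sum_exp_bitSign_le (b : ι → ℝ) :
    ∑ ε : ι → Bool, Real.exp (∑ i, bitSign (ε i) * b i) ≤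
      Fintype.card (ι → Bool) * Real.exp ((∑ i, b i ^ 2) / 2) := by
  have h1 : ∑ ε : ι → Bool, Real.exp (∑ i, bitSign (ε i) * b i) = ∏ i, (2 * Real.cosh (b i)) := by
    have h := Finset.prod_univ_sum (fun _ : ι => (Finset.univ : Finset Bool))
      fun i x => Real.exp (bitSign x * b i)
    rw [Fintype.piFinset_univ] at h
    simp only [Real.exp_sum]
    rw [← h]
    refine Finset.prod_congr rfl fun i _ => ?_
    rw [Fintype.sum_bool, Real.cosh_eq]
    simp only [bitSign]
    norm_num
    ring
  rw [h1, Finset.prod_mul_distrib, Finset.sum_div, Real.exp_sum]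
  refine mul_le_mul (le_of_eq (by simp)) (Finset.prod_le_prod
    (fun i _ => (Real.cosh_pos _).le) fun i _ => Real.cosh_le_exp_half_sq _)
    (Finset.prod_nonneg fun i _ => (Real.cosh_pos _).le) (by positivity)

/-- For x ≥ 1 one has x^p ≤ x^q ≤ q! e^x, and e^|S| ≤ e^S + e^(-S). The bound sees `b` only through
its square sum, so it is uniform in the number of bits. -/
theorem bitMean_rpow_le (b : ι → ℝ) {B c p : ℝ} (q : ℕ) (hp : 0 < p) (hpq : p ≤ q) (hc : 1 ≤ c)
    (hb : ∑ i, b i ^ 2 ≤ B) :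
    (bitMean fun ε => ENNReal.ofReal (c + |∑ i, bitSign (ε i) * b i|) ^ p) ≤
      ENNReal.ofReal (q.factorial * Real.exp c * (2 * Real.exp (B / 2))) := by
  set S : (ι → Bool) → ℝ := fun ε => ∑ i, bitSign (ε i) * b i with hS
  have hpt : ∀ ε, ENNReal.ofReal (c + |S ε|) ^ p ≤
      ENNReal.ofReal (q.factorial * Real.exp c * (Real.exp (S ε) + Real.exp (-S ε))) := by
    intro ε
    have h1 : 1 ≤ c + |S ε| := by linarith [abs_nonneg (S ε)]
    rw [ENNReal.ofReal_rpow_of_nonneg (by linarith) hp.le]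
    refine ENNReal.ofReal_le_ofReal ?_
    calc (c + |S ε|) ^ p ≤ (c + |S ε|) ^ (q : ℝ) := Real.rpow_le_rpow_of_exponent_le h1 hpq
      _ = (c + |S ε|) ^ q := Real.rpow_natCast _ _
      _ ≤ q.factorial * Real.exp (c + |S ε|) := by
        have := Real.pow_div_factorial_le_exp (c + |S ε|) (by linarith) q
        rwa [div_le_iff₀' (by positivity)] at this
      _ ≤ _ := by
        rw [Real.exp_add, ← mul_assoc]
        refine mul_le_mul_of_nonneg_left ?_ (by positivity)
        rcases abs_cases (S ε) with h | h
        · rw [h.1]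
          linarith [Real.exp_pos (-S ε)]
        · rw [h.1]
          linarith [Real.exp_pos (S ε)]
  refine (bitMean_mono hpt).trans ?_
  have hN : (0 : ℝ) < Fintype.card (ι → Bool) := by positivity
  have hneg : ∑ ε, Real.exp (-S ε) ≤ Fintype.card (ι → Bool) * Real.exp (B / 2) := by
    have := sum_exp_bitSign_le fun i => - b i
    simp only [neg_sq, mul_neg, Finset.sum_neg_distrib] at this
    exact this.trans (mul_le_mul_of_nonneg_left (Real.exp_le_exp.2 (by linarith)) hN.le)
  have hpos : ∑ ε, Real.exp (S ε) ≤ Fintype.card (ι → Bool) * Real.exp (B / 2) :=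
    (sum_exp_bitSign_le b).trans
      (mul_le_mul_of_nonneg_left (Real.exp_le_exp.2 (by linarith)) hN.le)
  rw [bitMean_eq, ← ENNReal.ofReal_sum_of_nonneg fun ε _ => by positivity,
    ← ENNReal.ofReal_natCast, ← ENNReal.ofReal_inv_of_pos hN, ← ENNReal.ofReal_mul (by positivity)]
  refine ENNReal.ofReal_le_ofReal ?_
  rw [← Finset.mul_sum, Finset.sum_add_distrib, inv_mul_le_iff₀ hN]
  calc _ ≤ q.factorial * Real.exp c * (Fintype.card (ι → Bool) * Real.exp (B / 2) +
        Fintype.card (ι → Bool) * Real.exp (B / 2)) :=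
        mul_le_mul_of_nonneg_left (add_le_add hpos hneg) (by positivity)
    _ = _ := by ring

end refresh

/-! ### A bump function -/

/-- The `j`-th derivative of the polynomial `(y (1 - y)) ^ (n + 1)`. -/
noncomputable def bump (n j : ℕ) (y : ℝ) : ℝ :=
  (Polynomial.derivative^[j] ((Polynomial.X * (1 - Polynomial.X)) ^ (n + 1) : Polynomial ℝ)).eval y

theorem hasDerivAt_bump (n j : ℕ) (y : ℝ) : HasDerivAt (bump n j) (bump n (j + 1) y) y := by
  have := (Polynomial.derivative^[j]
    ((Polynomial.X * (1 - Polynomial.X)) ^ (n + 1) : Polynomial ℝ)).hasDerivAt y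
  rw [← Function.iterate_succ_apply' Polynomial.derivative] at this
  exact this

theorem continuous_bump (n j : ℕ) : Continuous (bump n j) :=
  Polynomial.continuous _

/-- Both endpoints are roots of multiplicity at least n + 1. Hence a bump may change its sign there
without breaking the n-jet. -/
theorem bump_eq_zero {n j : ℕ} (hj : j ≤ n) {y : ℝ} (hy : y * (1 - y) = 0) : bump n j y = 0 := by
  have h0 : ((Polynomial.X * (1 - Polynomial.X)) ^ (n + 1) : Polynomial ℝ) ≠ 0 := by
    refine pow_ne_zero _ fun h => ?_
    have := congrArg (Polynomial.eval (2 : ℝ)) h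
    norm_num at this
  refine Polynomial.isRoot_iterate_derivative_of_lt_rootMultiplicity (lt_of_le_of_lt hj ?_)
  refine Nat.lt_of_succ_le ((Polynomial.le_rootMultiplicity_iff h0).2 (pow_dvd_pow_of_dvd ?_ _))
  rw [Polynomial.dvd_iff_isRoot]
  simpa [Polynomial.IsRoot] using hy

theorem pow_le_bump (n : ℕ) {y : ℝ} (h1 : 1 / 4 ≤ y) (h2 : y ≤ 3 / 4) :
    (3 / 16) ^ (n + 1) ≤ bump n 0 y := by
  have : bump n 0 y = (y * (1 - y)) ^ (n + 1) := by simp [bump]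
  rw [this]
  exact pow_le_pow_left₀ (by norm_num) (by nlinarith) _

theorem exists_bump_bound (n : ℕ) : ∃ M : ℝ, 0 ≤ M ∧ (∀ y ∈ Icc (0 : ℝ) 1, |bump n (n + 1) y| ≤ M) ∧
    ∀ y ∈ Icc (0 : ℝ) 1, ∀ z ∈ Icc (0 : ℝ) 1,
      |bump n (n + 1) z - bump n (n + 1) y| ≤ M * |z - y| := by
  obtain ⟨M₁, h1⟩ := isCompact_Icc.exists_bound_of_continuousOn
    (continuous_bump n (n + 1)).continuousOn (s := Icc (0 : ℝ) 1)
  obtain ⟨M₂, h2⟩ := isCompact_Icc.exists_bound_of_continuousOn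
    (continuous_bump n (n + 2)).continuousOn (s := Icc (0 : ℝ) 1)
  refine ⟨max M₁ M₂, ?_, fun y hy => (h1 y hy).trans (le_max_left _ _), fun y hy z hz => ?_⟩
  · exact ((norm_nonneg _).trans (h1 0 (by simp))).trans (le_max_left _ _)
  · exact (convex_Icc (0 : ℝ) 1).norm_image_sub_le_of_norm_hasDerivWithin_le
      (fun x _ => (hasDerivAt_bump n (n + 1) x).hasDerivWithinAt)
      (fun x hx => (h2 x hx).trans (le_max_right _ _)) hy hz

/-! ### Jets of random sums of bumps -/

namespace JetSpace

variable {n : ℕ} {ι : Type}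

theorem mod_add_one_le {q : ℕ} (hq : 0 < q) (τ : ℕ) : τ % q + 1 ≤ q := Nat.mod_lt _ hq

/-- The `(n + 1)`-st derivative at `K τ` of the bump on the interval of length `K q i`, up to sign. -/
noncomputable def topDeriv (n : ℕ) (a : ℝ) (q : ι → ℕ) (τ : ℕ) (i : ι) : ℝ :=
  a * bump n (n + 1) ((τ % q i : ℕ) / (q i : ℝ))

theorem mod_div_mem_Icc {q : ℕ} (hq : 0 < q) (τ : ℕ) {θ : ℝ} (hθ : θ ∈ Icc (0 : ℝ) 1) :
    (((τ % q : ℕ) : ℝ) + θ) / q ∈ Icc (0 : ℝ) 1 := by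
  have hq' : (0 : ℝ) < q := by exact_mod_cast hq
  have h1 : ((τ % q : ℕ) : ℝ) + 1 ≤ q := by exact_mod_cast mod_add_one_le hq τ
  refine ⟨div_nonneg (add_nonneg (Nat.cast_nonneg _) hθ.1) hq'.le, ?_⟩
  rw [div_le_one hq']
  linarith [hθ.2]

theorem abs_topDeriv_le {M : ℝ} (hM : ∀ y ∈ Icc (0 : ℝ) 1, |bump n (n + 1) y| ≤ M) {a : ℝ}
    (ha : 0 ≤ a) {q : ι → ℕ} (hq : ∀ i, 0 < q i) (τ : ℕ) (i : ι) : |topDeriv n a q τ i| ≤ a * M := by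
  rw [topDeriv, abs_mul, abs_of_nonneg ha]
  refine mul_le_mul_of_nonneg_left (hM _ ?_) ha
  simpa using mod_div_mem_Icc (hq i) τ (θ := 0) (by simp)

section

variable [Fintype ι]

/-- The derivatives, on the `τ`-th interval of length `K`, of the sum of bumps on the intervals of
lengths `K q i` around it with signs given by `ε`. -/
noncomputable def bumpSum (n : ℕ) (a K : ℝ) (q : ι → ℕ) (ε : ι → Bool) (τ j : ℕ) (x : ℝ) : ℝ :=
  ∑ i, bitSign (ε i) * (a * ((q i * K) ^ (n + 1 - j) *
    bump n j ((x - K * ((τ : ℝ) - (τ % q i : ℕ))) / (q i * K))))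

/-- The jet at `K τ` of the sum of bumps with signs given by `ε`. -/
noncomputable def bumpJet (n : ℕ) (a K : ℝ) (q : ι → ℕ) (ε : ι → Bool) (τ : ℕ) : JetSpace n :=
  ⟨K * τ, fun j => ∑ i, bitSign (ε i) * (a * ((q i * K) ^ (n + 1 - (j : ℕ)) *
    bump n j ((τ % q i : ℕ) / (q i : ℝ))))⟩

theorem hasDerivAt_bumpSum {a K : ℝ} (hK : 0 < K) {q : ι → ℕ} (hq : ∀ i, 0 < q i) (ε : ι → Bool)
    (τ : ℕ) {j : ℕ} (hj : j ≤ n) (x : ℝ) :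
    HasDerivAt (bumpSum n a K q ε τ j) (bumpSum n a K q ε τ (j + 1) x) x := by
  refine HasDerivAt.fun_sum fun i _ => ?_
  have hqi : (0 : ℝ) < q i := by exact_mod_cast hq i
  have h1 : HasDerivAt (fun x : ℝ => (x - K * ((τ : ℝ) - (τ % q i : ℕ))) / (q i * K))
      (1 / (q i * K)) x := ((hasDerivAt_id x).sub_const _).div_const _
  have h2 := ((((hasDerivAt_bump n j _).comp x h1).const_mul ((q i * K) ^ (n + 1 - j))).const_mul
    a).const_mul (bitSign (ε i))
  refine h2.congr_deriv ?_
  rw [show n + 1 - j = n + 1 - (j + 1) + 1 by omega, pow_succ]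
  field_simp

theorem continuous_bumpSum (n : ℕ) (a K : ℝ) (q : ι → ℕ) (ε : ι → Bool) (τ j : ℕ) :
    Continuous (bumpSum n a K q ε τ j) := by
  refine continuous_finsetSum _ fun i _ => continuous_const.mul (continuous_const.mul
    (continuous_const.mul ((continuous_bump n j).comp ?_)))
  fun_prop

theorem jetOf_bumpSum_left {a K : ℝ} (hK : 0 < K) (q : ι → ℕ) (ε : ι → Bool) (τ : ℕ) :
    (jetOf (bumpSum n a K q ε τ) (K * τ) : JetSpace n) = bumpJet n a K q ε τ := by
  ext j
  · rfl
  · refine Finset.sum_congr rfl fun i _ => ?_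
    rw [show K * (τ : ℝ) - K * ((τ : ℝ) - (τ % q i : ℕ)) = (τ % q i : ℕ) * K by ring,
      mul_div_mul_right _ _ hK.ne']

/-- A bump that ends at `K (τ + 1)` contributes a zero jet with either sign, so its new bit may be
used. For any other bump the residue of the time just grows by one. -/
theorem jetOf_bumpSum_right {a K : ℝ} (hK : 0 < K) {q : ι → ℕ} (hq : ∀ i, 0 < q i)
    {ε ε' : ι → Bool} (τ : ℕ) (h : ∀ i, ¬ q i ∣ τ + 1 → ε' i = ε i) :
    (jetOf (bumpSum n a K q ε τ) (K * (τ + 1)) : JetSpace n) = bumpJet n a K q ε' (τ + 1) := by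
  ext j
  · simp [jetOf, bumpJet]
  · refine Finset.sum_congr rfl fun i _ => ?_
    have hqi : (0 : ℝ) < q i := by exact_mod_cast hq i
    rw [show K * ((τ : ℝ) + 1) - K * ((τ : ℝ) - (τ % q i : ℕ)) = ((τ % q i : ℕ) + 1) * K by ring,
      mul_div_mul_right _ _ hK.ne']
    by_cases hd : q i ∣ τ + 1
    · have h1 : τ % q i + 1 = q i := by
        have h2 : q i ∣ τ % q i + 1 := by
          rw [Nat.dvd_iff_mod_eq_zero] at hd ⊢
          rwa [Nat.mod_add_mod]
        exact le_antisymm (mod_add_one_le (hq i) τ) (Nat.le_of_dvd (by omega) h2)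
      have h2 : ((τ % q i : ℕ) : ℝ) + 1 = q i := by exact_mod_cast h1
      rw [h2, div_self hqi.ne', Nat.mod_eq_zero_of_dvd hd, bump_eq_zero (by omega) (by simp),
        bump_eq_zero (by omega) (by simp)]
      simp
    · have h1 : (τ + 1) % q i = τ % q i + 1 := by
        rw [Nat.add_mod_eq_ite]
        have h3 := mod_add_one_le (hq i) τ
        have h4 : τ % q i + 1 ≠ q i := fun h4 => hd (by
          rw [Nat.dvd_iff_mod_eq_zero, ← Nat.mod_add_mod, h4, Nat.mod_self])
        have h5 : 1 % q i = 1 := Nat.mod_eq_of_lt (by omega)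
        rw [h5, if_neg (by omega)]
      rw [h i hd, h1]
      push_cast
      rfl

/-- The signed sum at the left end is kept intact because its cancellation is needed for the
moments. Only the variation within the step, at most `M / q i` times `a` by the Lipschitz bound, is
summed in absolute value. -/
theorem edist_bumpJet_succ_le {M : ℝ} (hM0 : 0 ≤ M)
    (hM : ∀ y ∈ Icc (0 : ℝ) 1, ∀ z ∈ Icc (0 : ℝ) 1,
      |bump n (n + 1) z - bump n (n + 1) y| ≤ M * |z - y|)
    {a K : ℝ} (ha : 0 ≤ a) (hK : 0 < K) {q : ι → ℕ} (hq : ∀ i, 0 < q i)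
    {ε ε' : ι → Bool} (τ : ℕ) (h : ∀ i, ¬ q i ∣ τ + 1 → ε' i = ε i) :
    edist (bumpJet n a K q ε τ) (bumpJet n a K q ε' (τ + 1)) ≤ ENNReal.ofReal
      (K * (1 + (|∑ i, bitSign (ε i) * topDeriv n a q τ i| + ∑ i, a * (M * (1 / q i))))) := by
  rw [← jetOf_bumpSum_left hK, ← jetOf_bumpSum_right hK hq τ h]
  have e : K = K * (τ + 1) - K * τ := by ring
  have hs : 0 ≤ ∑ i, a * (M * (1 / (q i : ℝ))) := Finset.sum_nonneg fun i _ => by positivity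
  refine (edist_jetOf_le (U := bumpSum n a K q ε τ) (a := K * τ) (b := K * (τ + 1))
    (M := |∑ i, bitSign (ε i) * topDeriv n a q τ i| + ∑ i, a * (M * (1 / q i)))
    (fun j hj x => hasDerivAt_bumpSum hK hq ε τ hj x) (by nlinarith)
    (add_nonneg (abs_nonneg _) hs) ?_ (continuous_bumpSum _ _ _ _ _ _ _)).trans (le_of_eq ?_)
  · intro x hx
    have h1 : bumpSum n a K q ε τ (n + 1) x = ∑ i, bitSign (ε i) * topDeriv n a q τ i +
        ∑ i, bitSign (ε i) * (a * (bump n (n + 1) ((x - K * ((τ : ℝ) - (τ % q i : ℕ))) / (q i * K))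
          - bump n (n + 1) ((τ % q i : ℕ) / (q i : ℝ)))) := by
      rw [bumpSum, ← Finset.sum_add_distrib]
      refine Finset.sum_congr rfl fun i _ => ?_
      rw [topDeriv, Nat.sub_self, pow_zero]
      ring
    rw [h1]
    refine (abs_add_le _ _).trans (add_le_add le_rfl ((Finset.abs_sum_le_sum_abs _ _).trans
      (Finset.sum_le_sum fun i _ => ?_)))
    rw [abs_mul, abs_bitSign, one_mul, abs_mul, abs_of_nonneg ha]
    refine mul_le_mul_of_nonneg_left ?_ ha
    have hqi : (0 : ℝ) < q i := by exact_mod_cast hq i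
    obtain ⟨θ, hθ, rfl⟩ : ∃ θ ∈ Icc (0 : ℝ) 1, x = K * (τ + θ) := by
      refine ⟨x / K - τ, ⟨?_, ?_⟩, by field_simp; ring⟩
      · rw [sub_nonneg, le_div_iff₀ hK]
        linarith [hx.1]
      · rw [sub_le_iff_le_add, div_le_iff₀ hK]
        linarith [hx.2]
    rw [show K * ((τ : ℝ) + θ) - K * ((τ : ℝ) - (τ % q i : ℕ)) = ((τ % q i : ℕ) + θ) * K by ring,
      mul_div_mul_right _ _ hK.ne']
    refine (hM _ (by simpa using mod_div_mem_Icc (hq i) τ (θ := 0) (by simp)) _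
      (mod_div_mem_Icc (hq i) τ hθ)).trans (mul_le_mul_of_nonneg_left ?_ hM0)
    rw [← sub_div, add_sub_cancel_left, abs_of_nonneg (div_nonneg hθ.1 hqi.le)]
    exact div_le_div_of_nonneg_right hθ.2 hqi.le
  · rw [← e]

theorem bumpJet_of_dvd (a K : ℝ) {q : ι → ℕ} (ε : ι → Bool) {τ : ℕ} (h : ∀ i, q i ∣ τ) :
    bumpJet n a K q ε τ = ⟨K * τ, 0⟩ := by
  ext j
  · rfl
  · refine Finset.sum_eq_zero fun i _ => ?_
    rw [Nat.mod_eq_zero_of_dvd (h i), bump_eq_zero (by omega) (by simp)]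
    simp

/-- The point depends only on the current bits, so it can be reached from 0 in `τ` steps with these
bits held fixed. -/
theorem edist_zero_bumpJet_le {M : ℝ} (hM0 : 0 ≤ M)
    (hM1 : ∀ y ∈ Icc (0 : ℝ) 1, |bump n (n + 1) y| ≤ M)
    (hM : ∀ y ∈ Icc (0 : ℝ) 1, ∀ z ∈ Icc (0 : ℝ) 1,
      |bump n (n + 1) z - bump n (n + 1) y| ≤ M * |z - y|)
    {a K : ℝ} (ha : 0 ≤ a) (hK : 0 < K) {q : ι → ℕ} (hq : ∀ i, 0 < q i) (ε : ι → Bool) (τ : ℕ) :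
    edist 0 (bumpJet n a K q ε τ) ≤
      ENNReal.ofReal (τ * (K * (1 + 2 * (Fintype.card ι * (a * M))))) := by
  have hC : 0 ≤ K * (1 + 2 * (Fintype.card ι * (a * M))) := by positivity
  induction τ with
  | zero =>
    rw [bumpJet_of_dvd _ _ _ fun i => dvd_zero _]
    have : (⟨K * ((0 : ℕ) : ℝ), 0⟩ : JetSpace n) = 0 := by
      rw [Nat.cast_zero, mul_zero]
      rfl
    rw [this, edist_self]
    exact zero_le
  | succ τ ih =>
    refine (edist_triangle _ (bumpJet n a K q ε τ) _).trans ((add_le_add ih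
      (edist_bumpJet_succ_le hM0 hM ha hK hq τ fun _ _ => rfl)).trans ?_)
    rw [← ENNReal.ofReal_add (by positivity) (mul_nonneg hK.le (add_nonneg zero_le_one (add_nonneg
      (abs_nonneg _) (Finset.sum_nonneg fun i _ => by positivity))))]
    refine ENNReal.ofReal_le_ofReal ?_
    have h1 : |∑ i, bitSign (ε i) * topDeriv n a q τ i| ≤ Fintype.card ι * (a * M) := by
      refine (Finset.abs_sum_le_sum_abs _ _).trans ?_
      rw [← nsmul_eq_mul]
      refine Finset.sum_le_card_nsmul _ _ _ fun i _ => ?_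
      rw [abs_mul, abs_bitSign, one_mul]
      exact abs_topDeriv_le hM1 ha hq τ i
    have h2 : ∑ i, a * (M * (1 / (q i : ℝ))) ≤ Fintype.card ι * (a * M) := by
      rw [← nsmul_eq_mul]
      refine Finset.sum_le_card_nsmul _ _ _ fun i _ => ?_
      have hqi : (1 : ℝ) ≤ q i := by exact_mod_cast hq i
      refine mul_le_mul_of_nonneg_left (mul_le_of_le_one_right hM0 ?_) ha
      rwa [div_le_one (by linarith)]
    push_cast
    nlinarith

/-- The other scales might cancel the contribution of `k` to the difference of the u_0-coordinates.
Reversing bit `k` in both strings shifts this difference by ±4 `w k`, so it cannot be smaller than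
`w k` in absolute value both before and after. -/
theorem le_edist_bumpJet_or [DecidableEq ι] {a K β : ℝ} (ha : 0 ≤ a) (hK : 0 < K) {q : ι → ℕ}
    {ε η : ι → Bool} {k : ι} (hk : ε k ≠ η k) {τ : ℕ}
    (h1 : 1 / 4 ≤ ((τ % q k : ℕ) / (q k : ℝ))) (h2 : ((τ % q k : ℕ) / (q k : ℝ)) ≤ 3 / 4)
    (hβ : 0 ≤ β) (hβ' : β ^ (n + 1) ≤ a * (q k * K * (3 / 16)) ^ (n + 1)) :
    ENNReal.ofReal β ≤ edist (bumpJet n a K q ε τ) (bumpJet n a K q η τ) ∨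
      ENNReal.ofReal β ≤
        edist (bumpJet n a K q (flipBit k ε) τ) (bumpJet n a K q (flipBit k η) τ) := by
  set w : ι → ℝ := fun i => a * ((q i * K) ^ (n + 1) * bump n 0 ((τ % q i : ℕ) / (q i : ℝ))) with hw
  have hu : ∀ ε : ι → Bool, (bumpJet n a K q ε τ).u 0 = ∑ i, bitSign (ε i) * w i := fun ε => rfl
  have key : ∀ ε η : ι → Bool,
      β ^ (n + 1) ≤ |(bumpJet n a K q ε τ).u 0 - (bumpJet n a K q η τ).u 0| →
      ENNReal.ofReal β ≤ edist (bumpJet n a K q ε τ) (bumpJet n a K q η τ) := by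
    intro ε η h
    have h3 := ofReal_abs_sub_u_le (v := bumpJet n a K q ε τ) (w := bumpJet n a K q η τ) rfl 0
    have h4 := (ENNReal.ofReal_le_ofReal h).trans h3
    rw [ENNReal.ofReal_pow hβ] at h4
    exact (ENNReal.pow_le_pow_left_iff (Nat.succ_ne_zero n)).1 h4
  have hwk : β ^ (n + 1) ≤ w k := by
    refine hβ'.trans (mul_le_mul_of_nonneg_left ?_ ha)
    rw [mul_pow _ (3 / 16 : ℝ)]
    exact mul_le_mul_of_nonneg_left (pow_le_bump n h1 h2) (by positivity)
  have hflip : ∀ ε : ι → Bool, ∑ i, bitSign (flipBit k ε i) * w i =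
      ∑ i, bitSign (ε i) * w i - 2 * (bitSign (ε k) * w k) := by
    intro ε
    rw [← Finset.add_sum_erase _ _ (Finset.mem_univ k),
      ← Finset.add_sum_erase _ (fun i => bitSign (ε i) * w i) (Finset.mem_univ k),
      flipBit_apply_self,
      Finset.sum_congr rfl fun i hi => by rw [flipBit_apply_of_ne (Finset.ne_of_mem_erase hi)]]
    cases ε k <;> simp [bitSign] <;> ring
  by_contra! hcon
  have c1 := lt_of_not_ge fun h => absurd (key ε η h) (not_le_of_gt hcon.1)
  have c2 := lt_of_not_ge fun h => absurd (key _ _ h) (not_le_of_gt hcon.2)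
  rw [hu, hu] at c1 c2
  rw [hflip, hflip] at c2
  rw [abs_lt] at c1 c2
  generalize ∑ i, bitSign (ε i) * w i = S at c1 c2
  generalize ∑ i, bitSign (η i) * w i = T at c1 c2
  have hβp : 0 ≤ β ^ (n + 1) := pow_nonneg hβ _
  cases h5 : ε k <;> cases h6 : η k <;> simp only [h5, h6, bitSign] at hk c1 c2 <;>
    first
    | exact hk rfl
    | (simp only [Bool.false_eq_true, if_true, if_false] at c2
       linarith [c1.1, c1.2, c2.1, c2.2])

end

end JetSpace

/-! ### The Markov convexity sums of the chain of random bumps -/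

namespace JetSpace

variable {n : ℕ} {ι : Type} [Fintype ι] [DecidableEq ι]

/-- The position at the time `z.1`, cut off to `[0, T]`, of the chain of random bumps. -/
noncomputable def bumpState (n : ℕ) (a K : ℝ) (q : ι → ℕ) (T : ℕ) (z : ℤ × (ι → Bool)) : JetSpace n :=
  bumpJet n a K q z.2 (min z.1.toNat T)

theorem tsum_expectedDistPow_stepLaw_le {p : ℝ} (hp : 0 < p) {Q : ℕ} (hpQ : p ≤ Q) {M : ℝ}
    (hM0 : 0 ≤ M) (hM : ∀ y ∈ Icc (0 : ℝ) 1, ∀ z ∈ Icc (0 : ℝ) 1,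
      |bump n (n + 1) z - bump n (n + 1) y| ≤ M * |z - y|)
    {a K : ℝ} (ha : 0 ≤ a) (hK : 0 < K) {q : ι → ℕ} (hq : ∀ i, 0 < q i) {T : ℕ}
    (hT : ∀ i, q i ∣ T) (hs : ∑ i, a * (M * (1 / (q i : ℝ))) ≤ M)
    (hs' : ∀ τ, ∑ i, topDeriv n a q τ i ^ 2 ≤ M ^ 2) {Y : Type*} [PseudoEMetricSpace Y]
    {f : ℤ × (ι → Bool) → Y}
    (hf : ∀ z w, edist (f z) (f w) ≤
      edist (bumpState n a K q T z) (bumpState n a K q T w) + ENNReal.ofReal (2 * K))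
    (hf0 : ∀ z w, bumpState n a K q T z = bumpState n a K q T w → f z = f w) :
    ∑' t : ℤ, expectedDistPow p f
        ((refreshChain fun t i => ((q i : ℕ) : ℤ) ∣ t).stepLaw t) ≤
      T * (ENNReal.ofReal K ^ p * ENNReal.ofReal
        (Q.factorial * Real.exp (3 + M) * (2 * Real.exp (M ^ 2 / 2)))) := by
  set A : ℤ → ι → Prop := fun t i => ((q i : ℕ) : ℤ) ∣ t with hA
  -- Outside [0, T) the times before and after the step, once cut off, are ends of all bumps, where
  -- the jet ignores the bits. By `hf0` such a step vanishes exactly; a mere rounding bound would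
  -- diverge when summed over all `t`.
  have hout : ∀ t ∉ Finset.Ico (0 : ℤ) T, expectedDistPow p f ((refreshChain A).stepLaw t) = 0 := by
    intro t ht
    change expectation _ _ = 0
    rw [expectation_refreshChain_stepLaw]
    have h : ∀ ε η : ι → Bool, edist (f (t, ε)) (f (t + 1, mix (A (t + 1)) ε η)) ^ p = 0 := by
      intro ε η
      rw [hf0 (t, ε) (t + 1, mix (A (t + 1)) ε η), edist_self, ENNReal.zero_rpow_of_pos hp]
      simp only [bumpState]
      rw [Finset.mem_Ico, not_and_or, not_le, not_lt] at ht
      rcases ht with ht | ht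
      · rw [show t.toNat = 0 by omega, show (t + 1).toNat = 0 by omega, Nat.zero_min,
          bumpJet_of_dvd _ _ _ fun i => dvd_zero _, bumpJet_of_dvd _ _ _ fun i => dvd_zero _]
      · rw [min_eq_right (by omega), min_eq_right (by omega), bumpJet_of_dvd _ _ _ hT,
          bumpJet_of_dvd _ _ _ hT]
    simp only [h, bitMean_const]
  rw [tsum_eq_sum hout]
  refine (Finset.sum_le_card_nsmul _ _ (ENNReal.ofReal K ^ p * ENNReal.ofReal
    (Q.factorial * Real.exp (3 + M) * (2 * Real.exp (M ^ 2 / 2)))) fun t ht => ?_).trans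
    (le_of_eq ?_)
  · change expectation _ _ ≤ _
    rw [expectation_refreshChain_stepLaw]
    rw [Finset.mem_Ico] at ht
    obtain ⟨τ, rfl⟩ := Int.eq_ofNat_of_zero_le ht.1
    have hτ : τ < T := by omega
    -- In 3 + M, the horizontal motion gives 1, rounding gives 2, and the variation within the step
    -- gives M.
    have h : ∀ ε η : ι → Bool, edist (f (τ, ε)) (f (τ + 1, mix (A (τ + 1)) ε η)) ^ p ≤
        ENNReal.ofReal K ^ p *
          ENNReal.ofReal (3 + M + |∑ i, bitSign (ε i) * topDeriv n a q τ i|) ^ p := by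
      intro ε η
      rw [← ENNReal.mul_rpow_of_nonneg _ _ hp.le, ← ENNReal.ofReal_mul hK.le]
      refine ENNReal.rpow_le_rpow ((hf _ _).trans ?_) hp.le
      have e1 : bumpState n a K q T ((τ : ℤ), ε) = bumpJet n a K q ε τ := by
        simp only [bumpState, Int.toNat_natCast]
        rw [min_eq_left hτ.le]
      have e2 : bumpState n a K q T ((τ : ℤ) + 1, mix (A (τ + 1)) ε η) =
          bumpJet n a K q (mix (A (τ + 1)) ε η) (τ + 1) := by
        simp only [bumpState]
        rw [show ((τ : ℤ) + 1).toNat = τ + 1 by omega, min_eq_left (by omega)]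
      rw [e1, e2]
      refine (add_le_add_left (edist_bumpJet_succ_le hM0 hM ha hK hq τ fun i hi =>
        mix_apply_of_not ?_ _ _) _).trans ?_
      · intro h
        exact hi (Int.natCast_dvd_natCast.1 (by push_cast; exact h))
      · have h0 := abs_nonneg (∑ i, bitSign (ε i) * topDeriv n a q τ i)
        have h1 : 0 ≤ ∑ i, a * (M * (1 / (q i : ℝ))) := Finset.sum_nonneg fun i _ => by positivity
        rw [← ENNReal.ofReal_add (by positivity) (by positivity)]
        refine ENNReal.ofReal_le_ofReal ?_
        nlinarith
    refine (bitMean_mono fun ε => bitMean_mono fun η => h ε η).trans ?_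
    simp only [bitMean_const]
    have hmul : ∀ (c : ℝ≥0∞) (g : (ι → Bool) → ℝ≥0∞),
        (bitMean fun ε => c * g ε) = c * bitMean g := fun c g => by
      rw [bitMean_eq, bitMean_eq, ← Finset.mul_sum, mul_left_comm]
    rw [hmul]
    exact mul_le_mul_right
      (bitMean_rpow_le (topDeriv n a q τ) Q hp hpQ (by linarith) (hs' τ)) _
  · rw [Int.card_Ico, sub_zero, Int.toNat_natCast, nsmul_eq_mul]

/-- The middle times are parametrised by the block and an offset below 2q: half of all times. -/
theorem card_mul_le_tsum {L q : ℕ} (hq : 0 < q) {F : ℤ → ℝ≥0∞} {v : ℝ≥0∞}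
    (h : ∀ t : ℕ, t < L * (4 * q) → q ≤ t % (4 * q) → t % (4 * q) ≤ 3 * q → v ≤ F t) :
    ((L * (2 * q) : ℕ) : ℝ≥0∞) * v ≤ ∑' t : ℤ, F t := by
  have hq4 : 0 < 4 * q := by omega
  set e : Fin L × Fin (2 * q) → ℤ := fun z => (((4 * q) * z.1 + (q + z.2) : ℕ) : ℤ)
  have hdiv : ∀ z : Fin L × Fin (2 * q), ((4 * q) * z.1 + (q + z.2) : ℕ) / (4 * q) = z.1 := by
    intro z
    have := z.2.2
    rw [Nat.mul_add_div hq4, Nat.div_eq_of_lt (by omega), add_zero]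
  have hmod : ∀ z : Fin L × Fin (2 * q), ((4 * q) * z.1 + (q + z.2) : ℕ) % (4 * q) = q + z.2 := by
    intro z
    have := z.2.2
    rw [Nat.mul_add_mod, Nat.mod_eq_of_lt (by omega)]
  have he : Function.Injective e := by
    intro z w hzw
    have hzw' : ((4 * q) * z.1 + (q + z.2) : ℕ) = (4 * q) * w.1 + (q + w.2) := Int.ofNat_inj.1 hzw
    have h1 := (hdiv z).symm.trans ((congrArg (· / (4 * q)) hzw').trans (hdiv w))
    have h2 := (hmod z).symm.trans ((congrArg (· % (4 * q)) hzw').trans (hmod w))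
    exact Prod.ext (Fin.ext h1) (Fin.ext (by omega))
  refine le_trans ?_ (ENNReal.tsum_comp_le_tsum_of_injective he F)
  rw [tsum_fintype]
  have : ∑ _z : Fin L × Fin (2 * q), v = ((L * (2 * q) : ℕ) : ℝ≥0∞) * v := by
    rw [Finset.sum_const, Finset.card_univ, Fintype.card_prod, Fintype.card_fin, Fintype.card_fin,
      nsmul_eq_mul]
  rw [← this]
  refine Finset.sum_le_sum fun z _ => h _ ?_ ?_ ?_
  · have h1 := z.1.2
    have h2 := z.2.2
    calc 4 * q * (z.1 : ℕ) + (q + z.2) < 4 * q * ((z.1 : ℕ) + 1) := by rw [mul_add]; omega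
      _ ≤ 4 * q * L := Nat.mul_le_mul_left _ h1
      _ = L * (4 * q) := mul_comm _ _
  · rw [hmod]
    omega
  · rw [hmod]
    have := z.2.2
    omega

theorem le_expectedDistPow_pairLaw {p : ℝ} (hp : 0 < p) {a K β : ℝ} (ha : 0 ≤ a) (hK : 0 < K)
    {q : ι → ℕ} {T : ℕ} {Y : Type*} [PseudoEMetricSpace Y] {f : ℤ × (ι → Bool) → Y}
    (hf : ∀ z w, edist (bumpState n a K q T z) (bumpState n a K q T w) ≤
      edist (f z) (f w) + ENNReal.ofReal (2 * K)) {i : ι} {k q' : ℕ} (hqk : q i = 2 ^ k)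
    (hq' : q i = 4 * q') {t : ℕ} (ht : t ≤ T)
    (h1 : q' ≤ t % (4 * q')) (h2 : t % (4 * q') ≤ 3 * q')
    (hβK : 4 * K ≤ β) (hβ' : β ^ (n + 1) ≤ a * (q i * K * (3 / 16)) ^ (n + 1)) :
    ENNReal.ofReal (β / 2) ^ p ≤ 4 * expectedDistPow p f
      ((refreshChain fun t i => ((q i : ℕ) : ℤ) ∣ t).pairLaw t (t - 2 ^ k)) := by
  set A : ℤ → ι → Prop := fun t i => ((q i : ℕ) : ℤ) ∣ t with hA
  have hβ : 0 ≤ β := by linarith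
  have hq0 : 0 < q i := by rw [hqk]; positivity
  have hq0' : (0 : ℝ) < q' := by
    have : 0 < q' := by omega
    exact_mod_cast this
  have hqR : (q i : ℝ) = 4 * q' := by rw [hq']; push_cast; ring
  change _ ≤ 4 * expectation _ _
  rw [expectation_refreshChain_pairLaw]
  set D : ι → Prop := fun i => ∃ u, (t : ℤ) - 2 ^ k < u ∧ u ≤ t ∧ A u i with hD
  -- The last multiple of `q i` up to `t` lies after t - 2^k, since `q i` = 2^k; so bit `i` was
  -- redrawn after the branching.
  have hDi : D i := by
    have h3 : t % q i < q i := Nat.mod_lt _ hq0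
    have h4 : q i * (t / q i) + t % q i = t := Nat.div_add_mod t (q i)
    have h5 : ((q i : ℕ) : ℤ) = 2 ^ k := by rw [hqk]; push_cast; ring
    refine ⟨((q i * (t / q i) : ℕ) : ℤ), ?_, ?_, ?_⟩
    · rw [← h5]
      omega
    · omega
    · exact Int.natCast_dvd_natCast.2 (dvd_mul_right _ _)
  refine le_four_mul_bitMean i fun ε η hεη => ?_
  have hmix : mix D (flipBit i ε) (flipBit i η) = flipBit i (mix D ε η) := by
    ext j
    by_cases hj : j = i
    · subst hj
      rw [mix_apply_of hDi, flipBit_apply_self, flipBit_apply_self, mix_apply_of hDi]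
    · rw [flipBit_apply_of_ne hj]
      simp only [mix, flipBit_apply_of_ne hj]
  have hstate : ∀ ε, bumpState n a K q T ((t : ℤ), ε) = bumpJet n a K q ε t := fun ε => by
    simp only [bumpState, Int.toNat_natCast]
    rw [min_eq_left ht]
  have key : ∀ ε η : ι → Bool, ENNReal.ofReal β ≤
      edist (bumpJet n a K q ε t) (bumpJet n a K q η t) →
      ENNReal.ofReal (β / 2) ^ p ≤ edist (f ((t : ℤ), ε)) (f ((t : ℤ), η)) ^ p := by
    intro ε η h
    refine ENNReal.rpow_le_rpow ?_ hp.le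
    have h3 := h.trans (by simpa only [hstate] using hf ((t : ℤ), ε) ((t : ℤ), η))
    -- Rounding costs 2K ≤ β/2.
    rw [← tsub_le_iff_right, ← ENNReal.ofReal_sub _ (by positivity)] at h3
    exact (ENNReal.ofReal_le_ofReal (by linarith)).trans h3
  have hor := le_edist_bumpJet_or (n := n) (τ := t) ha hK (q := q) (ε := ε) (η := mix D ε η)
    (k := i) (by rwa [mix_apply_of hDi]) (by
      rw [hqR, le_div_iff₀ (by positivity), hq']
      have : (q' : ℝ) ≤ (t % (4 * q') : ℕ) := by exact_mod_cast h1
      linarith) (by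
      rw [hqR, div_le_iff₀ (by positivity), hq']
      have : ((t % (4 * q') : ℕ) : ℝ) ≤ 3 * q' := by exact_mod_cast h2
      linarith) hβ hβ'
  rcases hor with h | h
  · exact (key _ _ h).trans le_self_add
  · rw [hmix]
    exact (key _ _ h).trans le_add_self

end JetSpace

/-! ### Markov convexity of coarsely dense subsets of balls -/

namespace JetSpace

variable {n : ℕ}

theorem le_tsum_expectedDistPow_pairLaw {p : ℝ} (hp : 0 < p) {a K α : ℝ} (ha : 0 ≤ a) (hK : 0 < K)
    {m : ℕ} (hm : 2 ≤ m) {Y : Type*} [PseudoEMetricSpace Y] {f : ℤ × (Fin m → Bool) → Y}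
    (hf : ∀ z w, edist (bumpState n a K (fun i : Fin m => 2 ^ (m + (i : ℕ))) (4 ^ m) z)
      (bumpState n a K (fun i : Fin m => 2 ^ (m + (i : ℕ))) (4 ^ m) w) ≤
      edist (f z) (f w) + ENNReal.ofReal (2 * K)) (hα : 0 ≤ α) (hαa : α ^ (n + 1) ≤ a)
    (hαm : 64 / 3 ≤ α * 2 ^ m) :
    m * (((4 ^ m : ℕ) : ℝ≥0∞) / 8 * ENNReal.ofReal (3 / 32 * α * K) ^ p) ≤
      ∑' k : ℕ, ∑' t : ℤ, expectedDistPow p f ((refreshChain fun t (i : Fin m) =>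
        ((2 ^ (m + (i : ℕ)) : ℕ) : ℤ) ∣ t).pairLaw t (t - 2 ^ k)) / (2 : ℝ≥0∞) ^ ((k : ℝ) * p) := by
  set q : Fin m → ℕ := fun i => 2 ^ (m + (i : ℕ)) with hq
  -- Only the scales k = m + i of the bumps are kept in the sum over k.
  have hinj : Function.Injective fun i : Fin m => m + (i : ℕ) := fun i j h => Fin.ext (by
    simpa using h)
  refine le_trans ?_ (ENNReal.tsum_comp_le_tsum_of_injective hinj _)
  rw [tsum_fintype]
  have hsum : (m : ℝ≥0∞) * (((4 ^ m : ℕ) : ℝ≥0∞) / 8 * ENNReal.ofReal (3 / 32 * α * K) ^ p) =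
      ∑ _i : Fin m, ((4 ^ m : ℕ) : ℝ≥0∞) / 8 * ENNReal.ofReal (3 / 32 * α * K) ^ p := by
    rw [Finset.sum_const, Finset.card_univ, Fintype.card_fin, nsmul_eq_mul]
  rw [hsum]
  refine Finset.sum_le_sum fun i _ => ?_
  set k := m + (i : ℕ) with hk
  have hi := i.2
  set q' := 2 ^ (k - 2) with hq'
  have hqq : q i = 4 * q' := by
    change 2 ^ k = 4 * 2 ^ (k - 2)
    rw [show (4 : ℕ) = 2 ^ 2 by norm_num, ← pow_add]
    congr 1
    omega
  have hT : 4 ^ m = 2 ^ (m - (i : ℕ)) * (4 * q') := by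
    rw [← hqq, show (4 : ℕ) = 2 ^ 2 by norm_num, ← pow_mul]
    change _ = 2 ^ (m - (i : ℕ)) * 2 ^ (m + (i : ℕ))
    rw [← pow_add]
    congr 1
    omega
  -- With this `β`, half of it is 2^k times 3/32 α K, so the weight 2^(kp) cancels. The condition β
  -- ≥ 4K is where 64/3 comes from.
  set β := α * (q i * K * (3 / 16)) with hβ
  have hqR : (q i : ℝ) = 2 ^ k := by
    change ((2 ^ k : ℕ) : ℝ) = _
    push_cast
    rfl
  have hβ2 : ENNReal.ofReal (β / 2) = (2 : ℝ≥0∞) ^ (k : ℝ) * ENNReal.ofReal (3 / 32 * α * K) := by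
    rw [ENNReal.rpow_natCast, show (2 : ℝ≥0∞) = ENNReal.ofReal 2 by simp,
      ← ENNReal.ofReal_pow (by norm_num), ← ENNReal.ofReal_mul (by positivity), hβ, hqR]
    congr 1
    ring
  have hterm : ∀ t : ℕ, t < 2 ^ (m - (i : ℕ)) * (4 * q') → q' ≤ t % (4 * q') →
      t % (4 * q') ≤ 3 * q' → 4⁻¹ * ENNReal.ofReal (3 / 32 * α * K) ^ p ≤
        expectedDistPow p f ((refreshChain fun t (i : Fin m) =>
          ((q i : ℕ) : ℤ) ∣ t).pairLaw t (t - 2 ^ k)) / (2 : ℝ≥0∞) ^ ((k : ℝ) * p) := by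
    intro t ht h1 h2
    rw [← hT] at ht
    have hp2 : (2 : ℝ≥0∞) ^ ((k : ℝ) * p) ≠ 0 := by simp
    have hp2' : (2 : ℝ≥0∞) ^ ((k : ℝ) * p) ≠ ⊤ :=
      ENNReal.rpow_ne_top_of_nonneg (by positivity) (by simp)
    have h3 := le_expectedDistPow_pairLaw hp ha hK hf (i := i) (k := k) (q' := q') (β := β) rfl hqq
      ht.le h1 h2 (by
        have hk2 : (2 : ℝ) ^ m ≤ 2 ^ k := pow_le_pow_right₀ (by norm_num) (by omega)
        have := hαm.trans (mul_le_mul_of_nonneg_left hk2 hα)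
        rw [hβ, hqR]
        nlinarith) (by
        rw [hβ, mul_pow]
        exact mul_le_mul_of_nonneg_right hαa (by positivity))
    rw [hβ2, ENNReal.mul_rpow_of_nonneg _ _ hp.le, ← ENNReal.rpow_mul] at h3
    rw [ENNReal.le_div_iff_mul_le (Or.inl hp2) (Or.inl hp2'), mul_assoc, mul_comm (_ ^ p)]
    rw [ENNReal.inv_mul_le_iff (by simp) (by simp)]
    exact h3
  -- Half of the 4^m times count, each with the factor 1/4: this is the 4^m / 8.
  refine le_trans (le_of_eq ?_) (card_mul_le_tsum (by positivity) hterm)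
  have h2 : (2 : ℝ≥0∞) * 2⁻¹ = 1 := ENNReal.mul_inv_cancel (by simp) (by simp)
  have h4 : (4 : ℝ≥0∞)⁻¹ = 2⁻¹ * 2⁻¹ := by
    rw [← ENNReal.mul_inv (by simp) (by simp)]
    norm_num
  have h8 : (8 : ℝ≥0∞)⁻¹ = 2⁻¹ * 4⁻¹ := by
    rw [← ENNReal.mul_inv (by simp) (by simp)]
    norm_num
  rw [hT, div_eq_mul_inv, h8, h4]
  push_cast
  generalize ENNReal.ofReal (3 / 32 * α * K) ^ p = W
  calc _ = ((2 : ℝ≥0∞) * 2⁻¹) * (2 * 2⁻¹) * (2⁻¹ * 2 ^ (m - (i : ℕ)) * q' * W) := by ring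
    _ = (2 * 2⁻¹) * (2⁻¹ * 2 ^ (m - (i : ℕ)) * q' * W) := by rw [h2, one_mul]
    _ = _ := by ring

theorem le_of_markovConvexWith {p : ℝ} (hp : 0 < p) (hpn : p ≤ 2 * (n + 1)) :
    ∃ c D : ℝ, 0 < c ∧ 0 < D ∧ ∀ (K : ℝ≥0) (N : Set (JetSpace n)) (R : ℝ) (m : ℕ) (C : ℝ≥0),
      0 < K → CoarselyDenseWith K N → 2 ≤ m → 64 / 3 * √m ≤ 2 ^ m → K * (D * 8 ^ m) ≤ R →
      MarkovConvexWith p (ballIn N R) C →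
      c * (m : ℝ) ^ (1 / p - 1 / (2 * ((n : ℝ) + 1))) ≤ C := by
  obtain ⟨M, hM0, hM1, hM⟩ := exists_bump_bound n
  set Q := 2 * (n + 1) with hQ
  set C₁ : ℝ := Q.factorial * Real.exp (3 + M) * (2 * Real.exp (M ^ 2 / 2)) with hC₁
  have hC₁0 : 0 < C₁ := by positivity
  refine ⟨(1 / (8 * C₁)) ^ (1 / p) * (3 / 32), 2 + 2 * M, by positivity, by positivity, ?_⟩
  intro K N R m C hK hN hm hm2 hR hC
  have hK' : (0 : ℝ) < K := hK
  have hmR : (0 : ℝ) < m := by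
    have : 0 < m := by omega
    exact_mod_cast this
  have hm1 : (1 : ℝ) ≤ m := by
    have : 1 ≤ m := by omega
    exact_mod_cast this
  have hmp : (m : ℝ) ≤ 2 ^ m := by exact_mod_cast (Nat.lt_two_pow_self (n := m)).le
  set a : ℝ := 1 / √m with ha
  have hsq : 1 ≤ √(m : ℝ) := Real.one_le_sqrt.2 hm1
  have ha0 : 0 < a := by positivity
  have ha1 : a ≤ 1 := by
    rw [ha, div_le_one (by positivity)]
    exact hsq
  have hsqm : √(m : ℝ) * √m = m := Real.mul_self_sqrt hmR.le
  have hma : m * a = √m := by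
    rw [ha, mul_one_div, div_eq_iff (by positivity), hsqm]
  have hsm : √(m : ℝ) ≤ m := by nlinarith
  -- The (n+1)-st root turns a separation of u_0-coordinates into a distance; it produces the loss
  -- m^(-1/(2(n+1))).
  set α : ℝ := a ^ (1 / ((n : ℝ) + 1)) with hα
  have hα0 : 0 < α := by positivity
  have hαn : α ^ (n + 1) = a := by
    rw [hα, ← Real.rpow_natCast, ← Real.rpow_mul ha0.le]
    push_cast
    rw [one_div_mul_cancel (by positivity), Real.rpow_one]
  have haα : a ≤ α := by
    have := Real.rpow_le_rpow_of_exponent_ge ha0 ha1 (y := 1) (z := 1 / ((n : ℝ) + 1))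
      ((div_le_one (by positivity)).2 (by linarith [(Nat.cast_nonneg n : (0 : ℝ) ≤ n)]))
    rwa [Real.rpow_one] at this
  have hαm : 64 / 3 ≤ α * 2 ^ m := by
    refine le_trans ?_ (mul_le_mul_of_nonneg_right haα (by positivity))
    rw [ha, one_div_mul_eq_div, le_div_iff₀ (by positivity)]
    exact hm2
  set q : Fin m → ℕ := fun i => 2 ^ (m + (i : ℕ)) with hq
  have hq0 : ∀ i, 0 < q i := fun i => by positivity
  have hqT : ∀ i, q i ∣ 4 ^ m := fun i => by
    rw [show (4 : ℕ) = 2 ^ 2 by norm_num, ← pow_mul]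
    exact pow_dvd_pow 2 (by omega)
  choose g hgN hg using hN
  have hball : ∀ z, g (bumpState n a K q (4 ^ m) z) ∈ ballIn N R := by
    intro z
    refine ⟨hgN _, (edist_triangle _ (bumpState n a K q (4 ^ m) z) _).trans ?_⟩
    have h1 := edist_zero_bumpJet_le hM0 hM1 hM ha0.le hK' hq0 z.2 (min z.1.toNat (4 ^ m))
    refine (add_le_add h1 (hg _)).trans ?_
    rw [← ENNReal.ofReal_coe_nnreal, ← ENNReal.ofReal_add (by positivity) hK'.le]
    refine ENNReal.ofReal_le_ofReal (le_trans ?_ hR)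
    rw [Fintype.card_fin, ← mul_assoc (m : ℝ), hma]
    have h2 : ((min z.1.toNat (4 ^ m) : ℕ) : ℝ) ≤ 4 ^ m := by
      exact_mod_cast min_le_right _ _
    have h3 : (8 : ℝ) ^ m = 4 ^ m * 2 ^ m := by rw [← mul_pow]; norm_num
    have h4 : (1 : ℝ) ≤ 4 ^ m := one_le_pow₀ (by norm_num)
    have h5 : (1 : ℝ) ≤ 2 ^ m := one_le_pow₀ (by norm_num)
    have h6 : √(m : ℝ) * M ≤ 2 ^ m * M := mul_le_mul_of_nonneg_right (hsm.trans hmp) hM0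
    calc ((min z.1.toNat (4 ^ m) : ℕ) : ℝ) * (K * (1 + 2 * (√(m : ℝ) * M))) + K
        ≤ 4 ^ m * (K * (2 ^ m + 2 * (2 ^ m * M))) + 4 ^ m * 2 ^ m * K := by
          refine add_le_add (mul_le_mul h2 (mul_le_mul_of_nonneg_left (by linarith) hK'.le)
            (by positivity) (by positivity)) (le_mul_of_one_le_left hK'.le ?_)
          exact one_le_mul_of_one_le_of_one_le h4 h5
      _ = K * ((2 + 2 * M) * 8 ^ m) := by rw [h3]; ring
  set f : ℤ × (Fin m → Bool) → ballIn N R := fun z => ⟨g (bumpState n a K q (4 ^ m) z), hball z⟩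
    with hf
  have h2K : ENNReal.ofReal (2 * K) = K + K := by
    rw [two_mul, ENNReal.ofReal_add hK'.le hK'.le, ENNReal.ofReal_coe_nnreal]
  have hg' : ∀ v, edist (g v) v ≤ K := fun v => by rw [edist_comm]; exact hg v
  have hf1 : ∀ z w, edist (f z) (f w) ≤
      edist (bumpState n a K q (4 ^ m) z) (bumpState n a K q (4 ^ m) w) +
        ENNReal.ofReal (2 * K) := by
    intro z w
    refine (edist_triangle4 _ (bumpState n a K q (4 ^ m) z) (bumpState n a K q (4 ^ m) w) _).trans ?_
    refine (add_le_add (add_le_add (hg' _) le_rfl) (hg _)).trans (le_of_eq ?_)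
    rw [h2K]
    ring
  have hf2 : ∀ z w, edist (bumpState n a K q (4 ^ m) z) (bumpState n a K q (4 ^ m) w) ≤
      edist (f z) (f w) + ENNReal.ofReal (2 * K) := by
    intro z w
    refine (edist_triangle4 _ (g (bumpState n a K q (4 ^ m) z))
      (g (bumpState n a K q (4 ^ m) w)) _).trans ?_
    refine (add_le_add (add_le_add (hg _) le_rfl) (hg' _)).trans (le_of_eq ?_)
    rw [h2K, Subtype.edist_eq]
    ring
  have hf0 : ∀ z w, bumpState n a K q (4 ^ m) z = bumpState n a K q (4 ^ m) w → f z = f w := by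
    intro z w h
    simp only [hf, h]
  -- As every `q i` is at least 2^m ≥ m, the m corrections add up to at most M.
  have hsum1 : ∑ i, a * (M * (1 / (q i : ℝ))) ≤ M := by
    have h1 : ∀ i ∈ Finset.univ, a * (M * (1 / (q i : ℝ))) ≤ M * (1 / 2 ^ m) := by
      intro i _
      have h2 : (2 : ℝ) ^ m ≤ q i := by
        have : 2 ^ m ≤ q i := Nat.pow_le_pow_right (by norm_num) (by omega)
        exact_mod_cast this
      calc a * (M * (1 / (q i : ℝ))) ≤ 1 * (M * (1 / 2 ^ m)) := by
            refine mul_le_mul ha1 (mul_le_mul_of_nonneg_left ?_ hM0) (by positivity) zero_le_one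
            exact one_div_le_one_div_of_le (by positivity) h2
        _ = _ := one_mul _
    refine (Finset.sum_le_card_nsmul _ _ _ h1).trans ?_
    rw [Finset.card_univ, Fintype.card_fin, nsmul_eq_mul, mul_left_comm, mul_one_div]
    exact mul_le_of_le_one_right hM0 ((div_le_one (by positivity)).2 hmp)
  have hsum2 : ∀ τ, ∑ i, topDeriv n a q τ i ^ 2 ≤ M ^ 2 := by
    intro τ
    have h1 : ∀ i ∈ Finset.univ, topDeriv n a q τ i ^ 2 ≤ (a * M) ^ 2 := fun i _ =>
      sq_le_sq.2 ((abs_topDeriv_le hM1 ha0.le hq0 τ i).trans (le_abs_self _))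
    refine (Finset.sum_le_card_nsmul _ _ _ h1).trans (le_of_eq ?_)
    rw [Finset.card_univ, Fintype.card_fin, nsmul_eq_mul, mul_pow, ← mul_assoc, ha, div_pow,
      Real.sq_sqrt hmR.le, one_pow, mul_one_div_cancel hmR.ne', one_mul]
  have hup := tsum_expectedDistPow_stepLaw_le hp (Q := Q) (by rw [hQ]; push_cast; exact hpn) hM0 hM
    ha0.le hK' hq0 hqT hsum1 hsum2 hf1 hf0
  have hlow := le_tsum_expectedDistPow_pairLaw hp ha0.le hK' hm hf2 hα0.le hαn.le hαm
  have hmain := hlow.trans ((hC _ _ f).trans (mul_le_mul_right hup _))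
  rw [← ENNReal.ofReal_coe_nnreal (p := C), ENNReal.ofReal_rpow_of_nonneg C.coe_nonneg hp.le,
    ENNReal.ofReal_rpow_of_nonneg hK'.le hp.le, ENNReal.ofReal_rpow_of_nonneg (by positivity) hp.le,
    show (8 : ℝ≥0∞) = ENNReal.ofReal 8 by simp, ← ENNReal.ofReal_natCast m,
    ← ENNReal.ofReal_natCast (4 ^ m), ← ENNReal.ofReal_div_of_pos (by norm_num),
    ← ENNReal.ofReal_mul (by positivity), ← ENNReal.ofReal_mul (by positivity),
    ← ENNReal.ofReal_mul (by positivity), ← ENNReal.ofReal_mul (by positivity),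
    ← ENNReal.ofReal_mul (by positivity), ENNReal.ofReal_le_ofReal_iff (by positivity),
    Real.mul_rpow (by positivity) hK'.le] at hmain
  have hcan : 0 < ((4 ^ m : ℕ) : ℝ) * (K : ℝ) ^ p := by positivity
  have h1 : (m : ℝ) * (1 / (8 * C₁)) * (3 / 32 * α) ^ p ≤ (C : ℝ) ^ p := by
    have h2 : (m : ℝ) / 8 * (3 / 32 * α) ^ p ≤ (C : ℝ) ^ p * C₁ := by
      refine le_of_mul_le_mul_right ?_ hcan
      calc _ = _ := by ring
        _ ≤ _ := hmain
        _ = _ := by ring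
    calc (m : ℝ) * (1 / (8 * C₁)) * (3 / 32 * α) ^ p = (m : ℝ) / 8 * (3 / 32 * α) ^ p / C₁ := by
          field_simp
      _ ≤ _ := (div_le_iff₀ hC₁0).2 h2
  have h3 := Real.rpow_le_rpow (by positivity) h1 (one_div_pos.2 hp).le
  rw [← Real.rpow_mul C.coe_nonneg, mul_one_div_cancel hp.ne', Real.rpow_one,
    Real.mul_rpow (by positivity) (by positivity), ← Real.rpow_mul (by positivity),
    mul_one_div_cancel hp.ne', Real.rpow_one, Real.mul_rpow (by positivity) (by positivity)] at h3
  refine le_trans (le_of_eq ?_) h3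
  have h4 : α = (m : ℝ) ^ (-(1 / (2 * ((n : ℝ) + 1)))) := by
    rw [hα, ha, one_div (√(m : ℝ)), Real.sqrt_eq_rpow, ← Real.rpow_neg hmR.le, ← Real.rpow_mul hmR.le]
    congr 1
    field_simp
  rw [h4, sub_eq_add_neg, Real.rpow_add hmR]
  ring

end JetSpace

/-! ### The lower bounds for the Markov convexity constants -/

namespace JetSpace

variable {n : ℕ}

theorem one_le_markovConvexityConst_ballIn {p : ℝ} (hp : 0 < p) {N : Set (JetSpace n)} {R : ℝ}
    (h : (ballIn N R).Nontrivial) : 1 ≤ markovConvexityConst p (ballIn N R) := by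
  obtain ⟨v, hv, w, hw, hvw⟩ := h
  refine one_le_markovConvexityConst hp (a := ⟨v, hv⟩) (b := ⟨w, hw⟩)
    (fun h => hvw (eq_of_edist_eq_zero h)) ?_
  rw [Subtype.edist_eq]
  refine ne_top_of_le_ne_top ?_ (edist_triangle_left v w 0)
  exact ENNReal.add_ne_top.2 ⟨ne_top_of_le_ne_top ENNReal.ofReal_ne_top hv.2,
    ne_top_of_le_ne_top ENNReal.ofReal_ne_top hw.2⟩

theorem edist_axis_le {x y : ℝ} (h : x ≤ y) :
    edist (⟨x, 0⟩ : JetSpace n) ⟨y, 0⟩ ≤ ENNReal.ofReal (y - x) := by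
  have := edist_jetOf_le (n := n) (U := fun _ _ => 0) (fun _ _ x => hasDerivAt_const x 0) (M := 0) h
    le_rfl (by simp) continuous_const
  rw [add_zero, mul_one] at this
  exact this

/-- The points with x = ±2K on the axis have neighbours in `N` whose x-coordinates have opposite
signs. -/
theorem ballIn_nontrivial {K : ℝ≥0} (hK : 0 < K) {N : Set (JetSpace n)}
    (hN : CoarselyDenseWith K N) {R : ℝ} (hR : 3 * (K : ℝ) ≤ R) : (ballIn N R).Nontrivial := by
  have hK' : (0 : ℝ) < K := hK
  have key : ∀ v : JetSpace n, edist 0 v ≤ ENNReal.ofReal (2 * K) →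
      ∃ w ∈ ballIn N R, |v.x - w.x| ≤ K := by
    intro v hv
    obtain ⟨w, hw, hvw⟩ := hN v
    refine ⟨w, ⟨hw, (edist_triangle _ v _).trans ((add_le_add hv hvw).trans ?_)⟩, ?_⟩
    · rw [← ENNReal.ofReal_coe_nnreal, ← ENNReal.ofReal_add (by positivity) hK'.le]
      exact ENNReal.ofReal_le_ofReal (by linarith)
    · have := (ofReal_abs_sub_x_le v w).trans hvw
      rwa [← ENNReal.ofReal_coe_nnreal, ENNReal.ofReal_le_ofReal_iff hK'.le] at this
  obtain ⟨v, hv, hv'⟩ := key ⟨2 * K, 0⟩ (by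
    have := edist_axis_le (n := n) (x := 0) (y := 2 * K) (by positivity)
    rwa [sub_zero] at this)
  obtain ⟨w, hw, hw'⟩ := key ⟨-(2 * K), 0⟩ (by
    have := edist_axis_le (n := n) (x := -(2 * K)) (y := 0) (by linarith)
    rwa [zero_sub, neg_neg, edist_comm] at this)
  refine ⟨v, hv, w, hw, fun h => ?_⟩
  subst h
  rw [abs_le] at hv' hw'
  simp only at hv' hw'
  linarith [hv'.2, hw'.1]

/-! ### Elementary estimates and the choice of the number of scales -/

theorem exists_mul_rpow_le_one (e L₁ : ℝ) : ∃ c : ℝ, 0 < c ∧ ∀ L, 1 ≤ L → L ≤ L₁ → c * L ^ e ≤ 1 := by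
  refine ⟨(max 1 (L₁ ^ e))⁻¹, by positivity, fun L h1 h2 => ?_⟩
  rw [inv_mul_le_iff₀ (by positivity), mul_one]
  rcases le_total e 0 with he | he
  · exact (Real.rpow_le_one_of_one_le_of_nonpos h1 he).trans (le_max_left _ _)
  · exact (Real.rpow_le_rpow (by linarith) h2 he).trans (le_max_right _ _)

theorem one_le_log {R : ℝ} (hR : 3 ≤ R) : 1 ≤ Real.log R := by
  rw [Real.le_log_iff_exp_le (by linarith)]
  linarith [Real.exp_one_lt_d9]

theorem sqrt_growth {m : ℕ} (hm : 8 ≤ m) : 64 / 3 * √(m : ℝ) ≤ 2 ^ m := by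
  have h1 : 64 * m ≤ 3 * 2 ^ m := by
    induction m, hm using Nat.le_induction with
    | base => norm_num
    | succ m hm ih =>
      rw [pow_succ]
      omega
  have h2 : (64 : ℝ) * m ≤ 3 * 2 ^ m := by exact_mod_cast h1
  have h3 : √(m : ℝ) ≤ m := by
    refine Real.sqrt_le_iff.2 ⟨Nat.cast_nonneg _, ?_⟩
    have : (1 : ℝ) ≤ m := by exact_mod_cast (by omega : 1 ≤ m)
    nlinarith
  linarith

theorem exists_le_markovConvexityConst_of_large {p : ℝ} (hp : 0 < p) (hpn : p ≤ 2 * (n + 1)) :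
    ∃ c L₀ : ℝ, 0 < c ∧ ∀ (K : ℝ≥0) (N : Set (JetSpace n)) (R : ℝ), 1 ≤ K →
      CoarselyDenseWith K N → 3 * (K : ℝ) ^ 2 ≤ R → L₀ ≤ Real.log R →
        ENNReal.ofReal (c * Real.log R ^ (1 / p - 1 / (2 * ((n : ℝ) + 1)))) ≤
          markovConvexityConst p (ballIn N R) := by
  obtain ⟨c, D, hc, hD, H⟩ := le_of_markovConvexWith hp hpn
  set e := 1 / p - 1 / (2 * ((n : ℝ) + 1)) with he
  have he0 : 0 ≤ e := sub_nonneg.2 (one_div_le_one_div_of_le hp hpn)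
  -- The threshold 108 gives m ≥ 8 and m ≥ L/24; the other one gives D ≤ R^(1/4).
  refine ⟨c * (1 / 24) ^ e, max 108 (4 * Real.log D), by positivity, ?_⟩
  intro K N R hK hN hR hL
  set L := Real.log R with hLdef
  have hL1 : 108 ≤ L := (le_max_left _ _).trans hL
  have hL2 : 4 * Real.log D ≤ L := (le_max_right _ _).trans hL
  have hK1 : (1 : ℝ) ≤ K := hK
  have hR0 : 0 < R := by nlinarith
  -- Since 8 ≤ e^3, this yields 8^m ≤ R^(1/4). Together with D ≤ R^(1/4) and K ≤ R^(1/2) it keeps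
  -- the chain in the ball.
  set m := ⌊L / 12⌋₊ with hm
  have hm1 : (m : ℝ) ≤ L / 12 := Nat.floor_le (by linarith)
  have hm2 : L / 12 < m + 1 := Nat.lt_floor_add_one _
  have hm8 : 8 ≤ m := Nat.le_floor (by push_cast; linarith)
  have h8 : (8 : ℝ) ^ m ≤ Real.exp (L / 4) := by
    have h1 : (8 : ℝ) ≤ Real.exp 3 := by
      have : Real.exp 3 = Real.exp 1 ^ 3 := by rw [← Real.exp_nat_mul]; norm_num
      rw [this]
      have h2 : (2 : ℝ) ≤ Real.exp 1 := by linarith [Real.exp_one_gt_d9]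
      calc (8 : ℝ) = 2 ^ 3 := by norm_num
        _ ≤ _ := pow_le_pow_left₀ (by norm_num) h2 3
    calc (8 : ℝ) ^ m ≤ Real.exp 3 ^ m := pow_le_pow_left₀ (by norm_num) h1 m
      _ = Real.exp (m * 3) := (Real.exp_nat_mul _ _).symm
      _ ≤ _ := Real.exp_le_exp.2 (by linarith)
  have hDexp : D ≤ Real.exp (L / 4) := by
    rw [← Real.log_le_iff_le_exp hD]
    linarith
  have hsq : Real.exp (L / 4) * Real.exp (L / 4) = √R := by
    rw [← Real.exp_add, ← Real.exp_log hR0, ← hLdef, ← Real.exp_half]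
    congr 1
    ring
  have hKR : K * (D * 8 ^ m) ≤ R := by
    have h1 : (K : ℝ) ≤ √R := Real.le_sqrt_of_sq_le (by nlinarith)
    calc (K : ℝ) * (D * 8 ^ m) ≤ √R * √R := by
          refine mul_le_mul h1 ?_ (by positivity) (by positivity)
          rw [← hsq]
          exact mul_le_mul hDexp h8 (by positivity) (by positivity)
      _ = R := Real.mul_self_sqrt hR0.le
  refine le_iInf fun C => le_iInf fun hC => ?_
  have h1 := H K N R m C (lt_of_lt_of_le zero_lt_one hK) hN (by omega) (sqrt_growth hm8) hKR hC
  rw [← ENNReal.ofReal_coe_nnreal (p := C)]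
  refine ENNReal.ofReal_le_ofReal (le_trans ?_ h1)
  rw [mul_assoc, ← Real.mul_rpow (by norm_num) (by linarith)]
  exact mul_le_mul_of_nonneg_left (Real.rpow_le_rpow (by linarith) (by linarith) he0) hc.le

/-- When log R is bounded, or when p > 2(n+1) and the exponent is negative, the power of log R is
bounded and two distinct points in the ball suffice. -/
theorem exists_le_markovConvexityConst {p : ℝ} (hp : 0 < p) (n : ℕ) :
    ∃ c : ℝ, 0 < c ∧ ∀ (K : ℝ≥0) (N : Set (JetSpace n)) (R : ℝ), 1 ≤ K →
      CoarselyDenseWith K N → 3 * (K : ℝ) ^ 2 ≤ R →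
        ENNReal.ofReal (c * Real.log R ^ (1 / p - 1 / (2 * ((n : ℝ) + 1)))) ≤
          markovConvexityConst p (ballIn N R) := by
  set e := 1 / p - 1 / (2 * ((n : ℝ) + 1)) with he
  have hsmall : ∀ (K : ℝ≥0) (N : Set (JetSpace n)) (R : ℝ), 1 ≤ K →
      CoarselyDenseWith K N → 3 * (K : ℝ) ^ 2 ≤ R →
        3 ≤ R ∧ 1 ≤ markovConvexityConst p (ballIn N R) := by
    intro K N R hK hN hR
    have hK1 : (1 : ℝ) ≤ K := hK
    exact ⟨by nlinarith, one_le_markovConvexityConst_ballIn hp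
      (ballIn_nontrivial (lt_of_lt_of_le zero_lt_one hK) hN (by nlinarith))⟩
  by_cases hpn : p ≤ 2 * (n + 1)
  · obtain ⟨c₁, L₀, hc₁, H⟩ := exists_le_markovConvexityConst_of_large hp hpn
    obtain ⟨c₂, hc₂, H₂⟩ := exists_mul_rpow_le_one e L₀
    refine ⟨min c₁ c₂, lt_min hc₁ hc₂, fun K N R hK hN hR => ?_⟩
    obtain ⟨hR3, h1⟩ := hsmall K N R hK hN hR
    have hL := one_le_log hR3
    have hLe : 0 ≤ Real.log R ^ e := Real.rpow_nonneg (by linarith) _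
    rcases le_total L₀ (Real.log R) with h | h
    · exact (ENNReal.ofReal_le_ofReal (mul_le_mul_of_nonneg_right (min_le_left _ _) hLe)).trans
        (H K N R hK hN hR h)
    · refine le_trans ?_ h1
      rw [ENNReal.ofReal_le_one]
      exact (mul_le_mul_of_nonneg_right (min_le_right _ _) hLe).trans (H₂ _ hL h)
  · refine ⟨1, one_pos, fun K N R hK hN hR => ?_⟩
    obtain ⟨hR3, h1⟩ := hsmall K N R hK hN hR
    refine le_trans ?_ h1
    rw [ENNReal.ofReal_le_one, one_mul]
    refine Real.rpow_le_one_of_one_le_of_nonpos (one_le_log hR3) (sub_nonpos.2 ?_)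
    exact one_div_le_one_div_of_le (by positivity) (le_of_not_ge hpn)

/-- For R ≥ 3 the number log log R is at least log log 3 > 0, so dividing by its power costs only a
constant. -/
theorem exists_div_log_log_le {d e : ℝ} (hd : 0 ≤ d) : ∃ b : ℝ, 0 < b ∧ ∀ c R : ℝ, 0 < c → 3 ≤ R →
    c * b * (Real.log R ^ e / Real.log (Real.log R) ^ d) ≤ c * Real.log R ^ e := by
  have h3 : 0 < Real.log (Real.log 3) := by
    refine Real.log_pos ?_
    rw [Real.lt_log_iff_exp_lt (by norm_num)]
    linarith [Real.exp_one_lt_d9]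
  refine ⟨Real.log (Real.log 3) ^ d, by positivity, fun c R hc hR => ?_⟩
  have hL := one_le_log hR
  have h1 : Real.log (Real.log 3) ≤ Real.log (Real.log R) :=
    Real.log_le_log (by linarith [one_le_log (le_refl (3 : ℝ))])
      (Real.log_le_log (by norm_num) hR)
  have h2 := Real.rpow_le_rpow h3.le h1 hd
  have h4 : 0 < Real.log (Real.log R) ^ d := Real.rpow_pos_of_pos (h3.trans_le h1) _
  rw [mul_assoc]
  refine mul_le_mul_of_nonneg_left ?_ hc.le
  rw [mul_div_assoc', div_le_iff₀ h4, mul_comm]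
  exact mul_le_mul_of_nonneg_left h2 (Real.rpow_nonneg (by linarith) _)

end JetSpace

theorem mainTheorem2 (p : ℝ) (hp : 0 < p) (r : ℕ) (hr : 1 ≤ r) :
    (∃ c : ℝ, 0 < c ∧ ∀ (K : ℝ≥0) (N : Set (JetSpace (r - 1))) (R : ℝ),
      1 ≤ K → CoarselyDenseWith K N → 3 * (K : ℝ) ^ 2 ≤ R →
        ENNReal.ofReal (c * (Real.log R ^ (1 / p - 1 / (2 * (r : ℝ))) /
            Real.log (Real.log R) ^ (1 / p + 1 / (2 * (r : ℝ)))))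
          ≤ markovConvexityConst p (JetSpace.ballIn N R)) ∧
    (∀ N : Set (JetSpace (r - 1)), CoarselyDense N →
      ∃ c : ℝ, 0 < c ∧ ∀ R : ℝ, 3 ≤ R → (JetSpace.ballIn N R).Nontrivial →
        ENNReal.ofReal (c * (Real.log R ^ (1 / p - 1 / (2 * (r : ℝ))) /
            Real.log (Real.log R) ^ (1 / p + 1 / (2 * (r : ℝ)))))
          ≤ markovConvexityConst p (JetSpace.ballIn N R)) := by
  have hcast : (((r - 1 : ℕ) : ℝ) + 1) = r := by
    rw [Nat.cast_sub hr]
    ring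
  obtain ⟨c, hc, H⟩ := JetSpace.exists_le_markovConvexityConst hp (r - 1)
  rw [hcast] at H
  set e := 1 / p - 1 / (2 * (r : ℝ)) with he
  obtain ⟨b, hb, Hb⟩ := JetSpace.exists_div_log_log_le (d := 1 / p + 1 / (2 * (r : ℝ))) (e := e)
    (by positivity)
  constructor
  · refine ⟨c * b, by positivity, fun K N R hK hN hR => ?_⟩
    have hK1 : (1 : ℝ) ≤ K := hK
    exact (ENNReal.ofReal_le_ofReal (Hb c R hc (by nlinarith))).trans (H K N R hK hN hR)
  · rintro N ⟨K', hK'⟩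
    set K := max K' 1 with hKdef
    have hN : CoarselyDenseWith K N := fun v => by
      obtain ⟨w, hw, h⟩ := hK' v
      exact ⟨w, hw, h.trans (ENNReal.coe_le_coe.2 (le_max_left _ _))⟩
    -- For R below 3K² the first part is not available, but log R stays bounded in terms of `N`, and
    -- the assumed two points give Π_p ≥ 1.
    obtain ⟨c₂, hc₂, H₂⟩ := JetSpace.exists_mul_rpow_le_one e (Real.log (3 * (K : ℝ) ^ 2))
    have hcm : 0 < min c c₂ := lt_min hc hc₂
    refine ⟨min c c₂ * b, by positivity, fun R hR hnt => ?_⟩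
    refine (ENNReal.ofReal_le_ofReal (Hb _ R hcm hR)).trans ?_
    have hL := JetSpace.one_le_log hR
    have hLe : 0 ≤ Real.log R ^ e := Real.rpow_nonneg (by linarith) _
    rcases le_total (3 * (K : ℝ) ^ 2) R with h | h
    · exact (ENNReal.ofReal_le_ofReal (mul_le_mul_of_nonneg_right (min_le_left _ _) hLe)).trans
        (H K N R (le_max_right _ _) hN h)
    · refine le_trans ?_ (JetSpace.one_le_markovConvexityConst_ballIn hp hnt)
      rw [ENNReal.ofReal_le_one]
      exact (mul_le_mul_of_nonneg_right (min_le_right _ _) hLe).trans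
        (H₂ _ hL (Real.log_le_log (by linarith) h))
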